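/- Let $\Gamma$ be a group and let $\mathcal F$ be a family of subgroups of $\Gamma$, i.e. a non-empty set of subgroups closed under conjugation and under taking subgroups. Let $\mathcal O_{\mathcal F}\Gamma$ be the orbit category, with objects the $\Gamma$-sets $\Gamma/H$ for $H\in\mathcal F$ and morphisms the $\Gamma$-maps, and let $\mathrm{cd}_{\mathcal F}(\Gamma)$ be the projective dimension of the constant functor $\underline{\mathbb Z}$ in the abelian category of contravariant functors from $\mathcal O_{\mathcal F}\Gamma$ to abelian groups. Let $\mathrm{gd}_{\mathcal F}(\Gamma)$ be the minimal dimension of a model for the classifying space $E_{\mathcal F}(\Gamma)$, i.e. of a $\Gamma$-CW complex $X$ (with $\Gamma$ discrete) whose fixed point space $X^H$ is contractible for every $H\in\mathcal F$ and empty for every subgroup $H\le\Gamma$ with $H\notin\mathcal F$. (Both dimensions may be infinite.) Suppose that $\mathcal F$ does not contain all finite subgroups of $\Gamma$. Then $\mathrm{cd}_{\mathcal F}(\Gamma)=1$ if and only if $\mathrm{gd}_{\mathcal F}(\Gamma)=1$. In fact, neither equality holds: $\mathrm{cd}_{\mathcal F}(\Gamma)\neq 1$ and $\mathrm{gd}_{\mathcal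 F}(\Gamma)\neq 1$. -/

import Mathlib

open CategoryTheory

universe u

/-- A family of subgroups of a group `Γ`: a non-empty collection of subgroups of `Γ` that is closed
under conjugation and under passing to subgroups. -/
structure SubgroupFamily (Γ : Type u) [Group Γ] where
  /-- The subgroups that belong to the family. -/
  carrier : Set (Subgroup Γ)
  nonempty : carrier.Nonempty
  conj_mem : ∀ H ∈ carrier, ∀ g : Γ, H.map (MulAut.conj g).toMonoidHom ∈ carrier
  mem_of_le : ∀ H ∈ carrier, ∀ K : Subgroup Γ, K ≤ H → K ∈ carrier

namespace SubgroupFamily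

variable {Γ : Type u} [Group Γ]

instance : Membership (Subgroup Γ) (SubgroupFamily Γ) where
  mem F H := H ∈ F.carrier

/-- The objects of the orbit category of `Γ` with respect to `F`: one object `Γ ⧸ H` for each
subgroup `H` in the family `F`. -/
structure OrbitCategory (F : SubgroupFamily Γ) : Type u where
  /-- The subgroup `H`, which stands for the `Γ`-set `Γ ⧸ H`. -/
  subgroup : Subgroup Γ
  mem : subgroup ∈ F

/-- Morphisms of the orbit category are the `Γ`-equivariant maps `Γ ⧸ H → Γ ⧸ K`. -/
instance (F : SubgroupFamily Γ) : Category.{u} F.OrbitCategory where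
  Hom A B := (Γ ⧸ A.subgroup) →[Γ] (Γ ⧸ B.subgroup)
  id A := MulActionHom.id Γ
  comp f g := MulActionHom.comp g f

/-- Modules over the orbit category: contravariant functors to abelian groups. -/
abbrev OrbitModule (F : SubgroupFamily Γ) : Type (u + 1) :=
  F.OrbitCategoryᵒᵖ ⥤ AddCommGrpCat.{u}

/-- The constant module, with value the abelian group `ℤ` on all objects (lifted to the universe
of `Γ`) and the identity on all morphisms. -/
def constantModule (F : SubgroupFamily Γ) : F.OrbitModule :=
  (Functor.const F.OrbitCategoryᵒᵖ).obj (AddCommGrpCat.of (ULift.{u} ℤ))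

/-- The cohomological dimension `cd_F(Γ)`: the projective dimension of the constant module `ℤ` in
the abelian category of modules over the orbit category. -/
noncomputable def cohomologicalDimension (F : SubgroupFamily Γ) : WithBot ℕ∞ :=
  projectiveDimension F.constantModule

end SubgroupFamily

/-- The structure of a `Γ`-CW complex on a `Γ`-space `X` (the group `Γ` is discrete): a CW structure
on `X` together with actions of `Γ` on the sets of `n`-cells such that translation by `g` carries
the characteristic map of the cell `i` to the characteristic map of the cell `g • i`. Thus the orbit
of an `n`-cell `i` with stabiliser `H` is an equivariant cell of type `Γ ⧸ H × Dⁿ`, with the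
equivariant characteristic map `(g H, x) ↦ g • map n i x`. (As in Mathlib's CW complexes, the disc
`Dⁿ` is the closed unit ball of `Fin n → ℝ`.) -/
structure EquivariantCWStructure (Γ : Type u) [Group Γ] (X : Type u) [TopologicalSpace X]
    [MulAction Γ X] where
  /-- The underlying CW structure on the whole space `X`. -/
  cw : Topology.CWComplex (Set.univ : Set X)
  /-- The action of `Γ` on the set of `n`-cells. -/
  cellAction : ∀ n : ℕ, MulAction Γ (cw.cell n)
  map_smul : ∀ (n : ℕ) (g : Γ) (i : cw.cell n), ∀ x ∈ Metric.closedBall (0 : Fin n → ℝ) 1,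
    cw.map n (g • i) x = g • cw.map n i x

/-- The CW dimension: the supremum of the dimensions of the cells (`⊥` if there are no cells, `⊤` if
the dimensions are unbounded). -/
noncomputable def EquivariantCWStructure.dim {Γ : Type u} [Group Γ] {X : Type u}
    [TopologicalSpace X] [MulAction Γ X] (C : EquivariantCWStructure Γ X) : WithBot ℕ∞ :=
  ⨆ (n : ℕ) (_ : Nonempty (C.cw.cell n)), (n : WithBot ℕ∞)

namespace SubgroupFamily

variable {Γ : Type u} [Group Γ]

/-- The condition on fixed point spaces that makes a `Γ`-CW complex `X` a model for the classifying
space `E_F(Γ)`: the space of `H`-fixed points is contractible for `H` in `F` and empty otherwise. -/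
structure IsClassifying (F : SubgroupFamily Γ) (X : Type u) [TopologicalSpace X]
    [MulAction Γ X] : Prop where
  contractible : ∀ H ∈ F, ContractibleSpace (MulAction.fixedPoints H X)
  empty : ∀ H : Subgroup Γ, H ∉ F → MulAction.fixedPoints H X = ∅

/-- The geometric dimension `gd_F(Γ)`: the minimal dimension of a `Γ`-CW complex (a Hausdorff space
with a continuous action of the discrete group `Γ` and an equivariant CW structure) that is a model
for the classifying space `E_F(Γ)`. -/
noncomputable def geometricDimension (F : SubgroupFamily Γ) : WithBot ℕ∞ :=
  sInf {d : WithBot ℕ∞ | ∃ (X : Type u) (_ : TopologicalSpace X) (_ : T2Space X)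
    (_ : MulAction Γ X) (_ : ContinuousConstSMul Γ X) (C : EquivariantCWStructure Γ X),
    F.IsClassifying X ∧ C.dim = d}

end SubgroupFamily

/-! Either equality produces an `AugmentationRetract` for `F`: `Γ`-sets `V` and `E` with stabilizers
in `F` such that the augmentation kernel of `ℤ[V]` splits off `ℤ[E]`, compatibly with fixed points
of members of `F`. If cd = 1, the kernel of the augmentation from a free orbit module onto `ℤ` is
projective, hence a summand of a free module. If gd = 1, one takes the cellular chain complex of a
one-dimensional model.

Such a retract forces every finite subgroup into `F` (`mem_of_finite`). Restricting to a minimal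
finite subgroup outside `F` leaves a nontrivial finite group `G` and the family of all its proper
subgroups; `false_of_finite` excludes this as follows.

Call `K` isolating if no larger member of the family fixes two points of `V`. Then points of `E`
with stabilizer larger than `K` do not contribute (`r_d_filter`), and those with stabilizer exactly
`K` form a free set over `N(K)/K`. Since H¹ of a finite group with free coefficients vanishes, there
is an `N(K)`-invariant element of augmentation 1 supported on points fixed by `K`
(`exists_invariant`). Applied to a normal maximal subgroup this contradicts orbit lengths, so
maximal subgroups are self-normalizing, and a Schanuel argument (`transfer`) replaces `V` by the set
of maximal subgroups under conjugation.

Now let `K` be an intersection of two distinct maximal subgroups, of largest possible order; it is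
isolating. If `N(K)` had two orbits on the maximal subgroups containing `K`, then either one of them
has `N(K)`-stabilizers equal to `K`, and a cycle in a bipartite graph contradicts the splitting
(`false_of_nonfree`), or neither does, and Burnside's formula gives a contradiction
(`false_of_two_nonfree_orbits`). So there is one orbit; its length divides the augmentation 1 of the
invariant element, although it contains two distinct subgroups. -/

open Finsupp in
/-- For a `G`-set `V` let `ℤ[V]⁰` denote the elements of augmentation zero. An augmentation retract
exhibits the functor `K ↦ ℤ[V ^ K]⁰`, for `K` in a collection `𝓕` of subgroups, as a direct summand
of `K ↦ ℤ[E ^ K]`: `d u v` is the image of `u - v` under the inclusion, and `r` is the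
projection. -/
structure AugmentationRetract (G : Type*) [Group G] (𝓕 : Set (Subgroup G)) (V E : Type*)
    [MulAction G V] [MulAction G E] where
  d : V → V → E →₀ ℤ
  r : E → V →₀ ℤ
  d_add_d : ∀ u v w, d u v + d v w = d u w
  d_smul : ∀ (g : G) u v e, d (g • u) (g • v) (g • e) = d u v e
  r_smul : ∀ (g : G) e v, r (g • e) (g • v) = r e v
  d_le : ∀ K ∈ 𝓕, ∀ u v e, K ≤ MulAction.stabilizer G u → K ≤ MulAction.stabilizer G v →
    d u v e ≠ 0 → K ≤ MulAction.stabilizer G e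
  r_le : ∀ e v, r e v ≠ 0 → MulAction.stabilizer G e ≤ MulAction.stabilizer G v
  r_sum : ∀ e, linearCombination ℤ (fun _ : V => (1 : ℤ)) (r e) = 0
  r_d : ∀ u v, linearCombination ℤ r (d u v) = single u 1 - single v 1
  stabilizer_mem : ∀ v : V, MulAction.stabilizer G v ∈ 𝓕
  stabilizer_mem' : ∀ e : E, MulAction.stabilizer G e ∈ 𝓕
  exists_le : ∀ K ∈ 𝓕, ∃ v : V, K ≤ MulAction.stabilizer G v

/-! ### Augmentation retracts: restriction, change of `V`, and consequences for finite groups. -/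

namespace AugmentationRetract

open Finsupp MulAction

variable {G : Type*} [Group G] {𝓕 : Set (Subgroup G)} {V E : Type*} [MulAction G V] [MulAction G E]

lemma d_self (D : AugmentationRetract G 𝓕 V E) (v : V) : D.d v v = 0 := by
  simpa using D.d_add_d v v v

/-- The restriction of an augmentation retract to a subgroup. -/
def restrict {F : SubgroupFamily G} (D : AugmentationRetract G F.carrier V E) (H : Subgroup G) :
    AugmentationRetract H {K | K.map H.subtype ∈ F.carrier} V E where
  d := D.d
  r := D.r
  d_add_d := D.d_add_d
  d_smul g := D.d_smul g
  r_smul g := D.r_smul g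
  d_le K hK u v e hu hv he k hk := by
    refine D.d_le _ hK u v e ?_ ?_ he (Subgroup.mem_map_of_mem H.subtype hk)
    · rintro _ ⟨x, hx, rfl⟩; exact hu hx
    · rintro _ ⟨x, hx, rfl⟩; exact hv hx
  r_le e v h k hk := D.r_le e v h (x := (k : G)) hk
  r_sum := D.r_sum
  r_d := D.r_d
  stabilizer_mem v := by
    refine F.mem_of_le _ (D.stabilizer_mem v) _ ?_
    rintro _ ⟨x, hx, rfl⟩; exact hx
  stabilizer_mem' e := by
    refine F.mem_of_le _ (D.stabilizer_mem' e) _ ?_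
    rintro _ ⟨x, hx, rfl⟩; exact hx
  exists_le K hK := by
    obtain ⟨v, hv⟩ := D.exists_le _ hK
    exact ⟨v, fun k hk => hv (Subgroup.mem_map_of_mem H.subtype hk)⟩

/-- Transport the chosen image of an orbit representative; the stabilizer condition makes the result
independent of the transporting element. -/
lemma _root_.MulAction.exists_equivariant_of_stabilizer_le {X Y : Type*} [MulAction G X]
    [MulAction G Y] (h : ∀ x : X, ∃ y : Y, stabilizer G x ≤ stabilizer G y) :
    ∃ f : X → Y, ∀ (g : G) x, f (g • x) = g • f x := by
  classical
  choose y hy using h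
  let t : X → X := fun x => (Quotient.mk (orbitRel G X) x).out
  have ht : ∀ x, ∃ g : G, g • t x = x := fun x => by
    have : (orbitRel G X).r (t x) x := Quotient.exact (Quotient.out_eq _)
    obtain ⟨g, hg⟩ := (orbitRel G X).symm this
    exact ⟨g, hg⟩
  choose γ hγ using ht
  have htg : ∀ (g : G) x, t (g • x) = t x := fun g x => by
    simp only [t]; congr 1; exact Quotient.sound ⟨g, rfl⟩
  refine ⟨fun x => γ x • y (t x), fun g x => ?_⟩
  have h1 : (γ x)⁻¹ * g⁻¹ * γ (g • x) ∈ stabilizer G (t x) := by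
    have := hγ (g • x)
    rw [htg] at this
    rw [mem_stabilizer_iff, mul_smul, mul_smul, this, inv_smul_smul, inv_smul_eq_iff, hγ]
  have h2 := hy _ h1
  rw [mem_stabilizer_iff, mul_smul, mul_smul, inv_smul_eq_iff, inv_smul_eq_iff] at h2
  simp only [htg, h2]

lemma linearCombination_one_mapDomain {A B : Type*} (f : A → B) (x : A →₀ ℤ) :
    linearCombination ℤ (fun _ : B => (1 : ℤ)) (mapDomain f x) =
      linearCombination ℤ (fun _ : A => (1 : ℤ)) x := by
  rw [linearCombination_mapDomain]; rfl

lemma exists_of_mapDomain_ne_zero {A B : Type*} {f : A → B} {x : A →₀ ℤ} {b : B}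
    (h : mapDomain f x b ≠ 0) : ∃ a, x a ≠ 0 ∧ f a = b := by
  classical
  have := mapDomain_support (Finsupp.mem_support_iff.mpr h)
  simpa using this

lemma mapDomain_smul_smul_apply {A B : Type*} [MulAction G A] [MulAction G B] {f : A → B}
    (hf : ∀ (g : G) a, f (g • a) = g • f a) (g : G) {x y : A →₀ ℤ}
    (h : ∀ a, y (g • a) = x a) (b : B) : mapDomain f y (g • b) = mapDomain f x b := by
  have : y = mapDomain (g • ·) x := by
    ext a
    obtain ⟨a, rfl⟩ := MulAction.surjective g a
    rw [h, mapDomain_apply (MulAction.injective g)]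
  rw [this, ← mapDomain_comp, show f ∘ (g • ·) = (g • ·) ∘ f from funext (hf g), mapDomain_comp,
    mapDomain_apply (MulAction.injective g)]

/-- An augmentation retract for `V` gives one for every `G`-set `W` which admits equivariant maps
to and from `V` (a form of Schanuel's lemma). -/
noncomputable def transfer (D : AugmentationRetract G 𝓕 V E) {W : Type*} [MulAction G W]
    (a : W → V) (b : V → W) (ha : ∀ (g : G) x, a (g • x) = g • a x)
    (hb : ∀ (g : G) x, b (g • x) = g • b x) (hW : ∀ w : W, stabilizer G w ∈ 𝓕) :
    AugmentationRetract G 𝓕 W (E ⊕ W) where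
  -- The `E` summand contributes `b (a u) - b (a v)` after projection; the `W` summand supplies the
  -- error of `b ∘ a` against the identity.
  d u v := mapDomain Sum.inl (D.d (a u) (a v)) + mapDomain Sum.inr (single u 1 - single v 1)
  r := Sum.elim (fun e => mapDomain b (D.r e)) (fun w => single w 1 - single (b (a w)) 1)
  d_add_d u v w := by
    rw [← D.d_add_d (a u) (a v) (a w), mapDomain_add,
      ← sub_add_sub_cancel (single u (1 : ℤ)) (single v 1) (single w 1), mapDomain_add]
    abel
  d_smul g u v e := by
    classical
    rcases e with e | e
    · simp [Sum.smul_inl, mapDomain_apply Sum.inl_injective, mapDomain_of_notMem_range, ha, D.d_smul]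
    · simp [Sum.smul_inr, mapDomain_apply Sum.inr_injective, mapDomain_of_notMem_range,
        single_apply]
  r_smul g e v := by
    classical
    rcases e with e | e
    · exact mapDomain_smul_smul_apply hb g (D.r_smul g e) v
    · simp [Sum.smul_inr, ha, hb, single_apply]
  d_le K hK u v e hu hv he := by
    classical
    have hst : ∀ {w : W}, K ≤ stabilizer G w → K ≤ stabilizer G (a w) := fun h k hk => by
      rw [mem_stabilizer_iff, ← ha, h hk]
    rcases e with e | e
    · have h1 : D.d (a u) (a v) e ≠ 0 := by
        simpa [mapDomain_apply Sum.inl_injective, mapDomain_of_notMem_range] using he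
      intro k hk
      have := D.d_le K hK _ _ e (hst hu) (hst hv) h1 hk
      rw [mem_stabilizer_iff] at this ⊢
      rw [Sum.smul_inl, this]
    · have h1 : single u (1 : ℤ) e - single v (1 : ℤ) e ≠ 0 := by
        simpa [mapDomain_apply Sum.inr_injective, mapDomain_of_notMem_range] using he
      have h2 : u = e ∨ v = e := by
        by_contra! h
        simp [h.1, h.2] at h1
      intro k hk
      rw [mem_stabilizer_iff, Sum.smul_inr]
      rcases h2 with rfl | rfl
      · rw [hu hk]
      · rw [hv hk]
  r_le e v h := by
    classical
    rcases e with e | e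
    · obtain ⟨x, hx, rfl⟩ := exists_of_mapDomain_ne_zero h
      intro k hk
      have h1 : k ∈ stabilizer G e := by
        rw [mem_stabilizer_iff, Sum.smul_inl] at hk
        exact Sum.inl_injective hk
      have := D.r_le e x hx h1
      rw [mem_stabilizer_iff] at this ⊢
      rw [← hb, this]
    · intro k hk
      have h1 : k • e = e := by
        rw [mem_stabilizer_iff, Sum.smul_inr] at hk
        exact Sum.inr_injective hk
      have h2 : e = v ∨ b (a e) = v := by
        by_contra! hh
        simp [hh.1, hh.2] at h
      rw [mem_stabilizer_iff]
      rcases h2 with rfl | rfl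
      · exact h1
      · rw [← hb, ← ha, h1]
  r_sum e := by
    rcases e with e | e
    · exact (linearCombination_one_mapDomain _ _).trans (D.r_sum e)
    · simp
  r_d u v := by
    have h : ∀ x : E →₀ ℤ, linearCombination ℤ (fun e => mapDomain b (D.r e)) x =
        mapDomain b (linearCombination ℤ D.r x) := fun x => by
      rw [← lmapDomain_apply ℤ ℤ b, apply_linearCombination]
      rfl
    rw [map_add, linearCombination_mapDomain, linearCombination_mapDomain, Sum.elim_comp_inl,
      Sum.elim_comp_inr, h, D.r_d]
    simp [mapDomain_sub]
    abel
  stabilizer_mem := hW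
  stabilizer_mem' e := by
    rcases e with e | e
    · convert D.stabilizer_mem' e using 1
      ext g
      simp [mem_stabilizer_iff, Sum.smul_inl]
    · convert hW e using 1
      ext g
      simp [mem_stabilizer_iff, Sum.smul_inr]
  exists_le K hK := by
    obtain ⟨v, hv⟩ := D.exists_le K hK
    refine ⟨b v, fun k hk => ?_⟩
    rw [mem_stabilizer_iff, ← hb, hv hk]

lemma d_smul_eq (D : AugmentationRetract G 𝓕 V E) (g : G) (u v : V) (e : E) :
    D.d (g • u) (g • v) e = D.d u v (g⁻¹ • e) := by
  rw [← D.d_smul g u v (g⁻¹ • e), smul_inv_smul]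

lemma _root_.MulAction.le_stabilizer_smul {X : Type*} [MulAction G X] {K : Subgroup G} {x : X}
    (hx : K ≤ stabilizer G x) {w : G} (hw : w ∈ Subgroup.normalizer (K : Set G)) :
    K ≤ stabilizer G (w • x) := by
  intro k hk
  have : w⁻¹ * k * w ∈ K := (Subgroup.mem_normalizer_iff''.mp hw k).mp hk
  have h := hx this
  rw [mem_stabilizer_iff, mul_smul, mul_smul, inv_smul_eq_iff] at h
  exact h

lemma _root_.MulAction.stabilizer_smul_of_mem_normalizer {X : Type*} [MulAction G X]
    {K : Subgroup G} {x : X} (hx : stabilizer G x = K) {w : G}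
    (hw : w ∈ Subgroup.normalizer (K : Set G)) : stabilizer G (w • x) = K := by
  refine le_antisymm (fun k hk => ?_) (le_stabilizer_smul hx.ge hw)
  rw [Subgroup.mem_normalizer_iff''.mp hw k, ← hx, mem_stabilizer_iff, mul_smul, mul_smul,
    inv_smul_eq_iff]
  exact hk

/-- If no two points of `V` are fixed by a common subgroup in `𝓕` larger than `K`, then the points
of `E` with stabilizer `K` suffice to recover the differences of points fixed by `K`. -/
lemma r_d_filter (D : AugmentationRetract G 𝓕 V E) {K : Subgroup G} (hK : K ∈ 𝓕)
    [DecidablePred fun e : E => stabilizer G e = K]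
    (hL : ∀ L ∈ 𝓕, K < L → ∀ u v : V, L ≤ stabilizer G u → L ≤ stabilizer G v → u = v)
    {u v : V} (hu : K ≤ stabilizer G u) (hv : K ≤ stabilizer G v) :
    linearCombination ℤ D.r ((D.d u v).filter fun e => stabilizer G e = K) =
      single u 1 - single v 1 := by
  rw [← D.r_d u v]
  conv_rhs => rw [← filter_add_filter_not (D.d u v) (fun e => stabilizer G e = K), map_add]
  rw [left_eq_add, linearCombination_apply, Finsupp.sum]
  refine Finset.sum_eq_zero fun e he => ?_
  rw [Finsupp.support_filter, Finset.mem_filter, Finsupp.mem_support_iff] at he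
  have hlt : K < stabilizer G e :=
    lt_of_le_of_ne (D.d_le K hK u v e hu hv he.1) (Ne.symm he.2)
  suffices D.r e = 0 by rw [this, smul_zero]
  by_contra h
  obtain ⟨x, hx⟩ := Finsupp.ne_iff.mp h
  -- All points in the support of `D.r e` are fixed by `stabilizer G e`, which is larger than `K`,
  -- so there is only one; augmentation zero then kills its coefficient.
  have h1 : D.r e = single x (D.r e x) := by
    ext y
    classical
    by_cases hy : D.r e y = 0
    · rw [hy, single_apply]; split_ifs with hxy
      · subst hxy; exact hy.symm
      · rfl
    · obtain rfl := hL _ (D.stabilizer_mem' e) hlt x y (D.r_le e x hx) (D.r_le e y hy)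
      simp
  have h2 := D.r_sum e
  rw [h1] at h2
  simp at h2
  exact hx h2

/-- For a point `v₀` fixed by `K`, the part of `d (w • v₀) v₀` on points of stabilizer `K` is a
1-cocycle of the normalizer in a free module over `N(K)/K`, hence the coboundary of some `h`. Then
`v₀ - r h` is invariant, and `r h` has augmentation zero. -/
lemma exists_invariant [Finite G] (D : AugmentationRetract G 𝓕 V E) {K : Subgroup G} (hK : K ∈ 𝓕)
    (hL : ∀ L ∈ 𝓕, K < L → ∀ u v : V, L ≤ stabilizer G u → L ≤ stabilizer G v → u = v) :
    ∃ u : V →₀ ℤ, (∀ v, u v ≠ 0 → K ≤ stabilizer G v) ∧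
      linearCombination ℤ (fun _ : V => (1 : ℤ)) u = 1 ∧
      ∀ w ∈ Subgroup.normalizer (K : Set G), ∀ v, u (w • v) = u v := by
  classical
  obtain ⟨v₀, hv₀⟩ := D.exists_le K hK
  let N := Subgroup.normalizer (K : Set G)
  let t : E → E := fun x => (Quotient.mk (orbitRel N E) x).out
  have ht : ∀ x, ∃ g : N, g • t x = x := fun x => by
    have : (orbitRel N E).r (t x) x := Quotient.exact (Quotient.out_eq _)
    obtain ⟨g, hg⟩ := (orbitRel N E).symm this
    exact ⟨g, hg⟩
  choose n hn using ht
  have htg : ∀ (g : N) x, t (g • x) = t x := fun g x => by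
    simp only [t]; congr 1; exact Quotient.sound ⟨g, rfl⟩
  have hst : ∀ x, stabilizer G (t x) = K → stabilizer G x = K := fun x hx => by
    rw [← hn x]; exact stabilizer_smul_of_mem_normalizer hx (n x).2
  have hst' : ∀ x, stabilizer G x = K → stabilizer G (t x) = K := fun x hx => by
    rw [← inv_smul_eq_iff.mpr (hn x).symm]
    exact stabilizer_smul_of_mem_normalizer hx (n x)⁻¹.2
  let f : G → E →₀ ℤ := fun w => (D.d (w • v₀) v₀).filter fun e => stabilizer G e = K
  have hf : ∀ w e, stabilizer G e = K → f w e = D.d (w • v₀) v₀ e := fun w e he =>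
    filter_apply_pos _ _ he
  have hf0 : ∀ w e, stabilizer G e ≠ K → f w e = 0 := fun w e he => filter_apply_neg _ _ he
  -- On points of stabilizer `K`, the cocycle identity forces this value once `h` is required to
  -- vanish on the orbit representatives `t e`.
  let h₀ : E → ℤ := fun e => f ((n e)⁻¹ : N) (t e)
  have hfin : h₀.support.Finite := by
    refine (Set.finite_iUnion fun g : N => Set.finite_iUnion fun g' : N =>
      ((f (g' : G)).support.finite_toSet.image fun e => g • e)).subset ?_
    intro e he
    simp only [Set.mem_iUnion]
    exact ⟨n e, (n e)⁻¹, t e, by simpa [h₀] using he, hn e⟩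
  let h : E →₀ ℤ := Finsupp.ofSupportFinite h₀ hfin
  have hh : ∀ (w : N) e, h (w⁻¹ • e) - h e = f w e := by
    intro w e
    change h₀ (w⁻¹ • e) - h₀ e = f w e
    simp only [h₀, htg]
    by_cases he : stabilizer G e = K
    · have het := hst' e he
      rw [hf _ _ het, hf _ _ het, hf _ _ he]
      -- The two transporting elements agree up to an element of `K`, which fixes both `v₀` and `t
      -- e` and so drops out of the cocycle.
      have hk : (((n (w⁻¹ • e))⁻¹ * w⁻¹ * n e : N) : G) ∈ K := by
        rw [← het, mem_stabilizer_iff]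
        change ((n (w⁻¹ • e))⁻¹ * w⁻¹ * n e : N) • t e = t e
        rw [mul_smul, hn, mul_smul, inv_smul_eq_iff, ← htg w⁻¹ e, hn]
      set k := (n (w⁻¹ • e))⁻¹ * w⁻¹ * n e with hkdef
      have h1 : (((n (w⁻¹ • e))⁻¹ : N) : G) = k * (((n e)⁻¹ : N) : G) * w := by
        rw [← Subgroup.coe_mul, ← Subgroup.coe_mul]; congr 1; rw [hkdef]; group
      have h2 : (n (w⁻¹ • e))⁻¹ = k * (n e)⁻¹ * w := by rw [hkdef]; group
      have h3 : D.d (((n (w⁻¹ • e))⁻¹ : N) • v₀) v₀ (t e) =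
          D.d ((n e)⁻¹ • w • v₀) v₀ (t e) := by
        have e1 : (k : G)⁻¹ • v₀ = v₀ := hv₀ (K.inv_mem hk)
        have e2 : (k : G)⁻¹ • t e = t e := het.ge (K.inv_mem hk)
        have := D.d_smul (k : G)⁻¹ ((n (w⁻¹ • e))⁻¹ • v₀) v₀ (t e)
        rw [e1, e2] at this
        rw [← this, h2]
        congr 2
        change k⁻¹ • (k * (n e)⁻¹ * w) • v₀ = _
        simp only [mul_smul, inv_smul_smul]
      have h4 : D.d ((n e)⁻¹ • w • v₀) ((n e)⁻¹ • v₀) (t e) = D.d (w • v₀) v₀ e := by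
        have := D.d_smul ((n e)⁻¹ : N) (w • v₀) v₀ e
        rw [← this]
        congr 1
        change _ = (n e)⁻¹ • e
        rw [eq_inv_smul_iff, hn]
      have h5 := DFunLike.congr_fun (D.d_add_d ((n e)⁻¹ • w • v₀) ((n e)⁻¹ • v₀) v₀) (t e)
      rw [Finsupp.add_apply] at h5
      change D.d ((n (w⁻¹ • e))⁻¹ • v₀) v₀ (t e) - D.d ((n e)⁻¹ • v₀) v₀ (t e) =
        D.d (w • v₀) v₀ e
      rw [h3, ← h5, h4]
      ring
    · have het : stabilizer G (t e) ≠ K := fun h => he (hst e h)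
      rw [hf0 _ _ het, hf0 _ _ het, hf0 _ _ he, sub_zero]
  have hinv : ∀ (w : N) (x : E →₀ ℤ) v, linearCombination ℤ D.r x ((w : G)⁻¹ • v) =
      linearCombination ℤ D.r (mapDomain (fun e => (w : G) • e) x) v := by
    intro w x v
    rw [linearCombination_mapDomain, linearCombination_apply, linearCombination_apply,
      Finsupp.sum, Finsupp.sum, Finsupp.finsetSum_apply, Finsupp.finsetSum_apply]
    refine Finset.sum_congr rfl fun e _ => ?_
    simp only [Finsupp.smul_apply, Function.comp]
    rw [← D.r_smul (w : G) e ((w : G)⁻¹ • v), smul_inv_smul]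
  have hmap : ∀ (w : N) (x : E →₀ ℤ) e, mapDomain (fun e => (w : G) • e) x e = x (w⁻¹ • e) := by
    intro w x e
    have := mapDomain_apply (MulAction.injective (w : G)) x ((w : G)⁻¹ • e)
    rw [smul_inv_smul] at this
    exact this
  have hKh : ∀ v, linearCombination ℤ D.r h v ≠ 0 → K ≤ stabilizer G v := by
    intro v hv
    rw [linearCombination_apply, Finsupp.sum, Finsupp.finsetSum_apply] at hv
    obtain ⟨e, he, hev⟩ := Finset.exists_ne_zero_of_sum_ne_zero hv
    rw [Finsupp.mem_support_iff] at he
    have h1 : stabilizer G (t e) = K := by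
      by_contra hne
      exact he (hf0 _ _ hne)
    rw [← hst e h1]
    refine D.r_le e v fun h0 => hev ?_
    rw [Finsupp.smul_apply, h0, smul_zero]
  refine ⟨single v₀ 1 - linearCombination ℤ D.r h, fun v hv => ?_, ?_, ?_⟩
  · rw [Finsupp.sub_apply] at hv
    by_cases hvv : v₀ = v
    · exact hvv ▸ hv₀
    · refine hKh v fun h0 => hv ?_
      rw [single_eq_of_ne (Ne.symm hvv), h0, sub_zero]
  · rw [map_sub, linearCombination_single, apply_linearCombination, one_smul]
    have : (linearCombination ℤ (fun _ : V => (1 : ℤ))) ∘ D.r = 0 := funext D.r_sum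
    rw [this]
    simp
  · have key : ∀ w : N, ∀ v, (single v₀ 1 - linearCombination ℤ D.r h : V →₀ ℤ) ((w : G)⁻¹ • v) =
        (single v₀ 1 - linearCombination ℤ D.r h : V →₀ ℤ) v := by
      intro w v
      rw [Finsupp.sub_apply, Finsupp.sub_apply, hinv]
      have h1 : mapDomain (fun e => (w : G) • e) h = h + f w := by
        ext e
        rw [hmap, Finsupp.add_apply, ← hh]; ring
      have h2 : single v₀ (1 : ℤ) ((w : G)⁻¹ • v) = single ((w : G) • v₀) (1 : ℤ) v := by
        rw [single_apply, single_apply]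
        congr 1
        rw [eq_inv_smul_iff]
      have h3 := DFunLike.congr_fun
        (D.r_d_filter hK hL (le_stabilizer_smul hv₀ w.2) hv₀) v
      rw [h1, map_add, Finsupp.add_apply, h2]
      change linearCombination ℤ D.r (f w) v = _ at h3
      rw [h3, Finsupp.sub_apply]
      ring
    intro w hw v
    have := key ⟨w, hw⟩⁻¹ v
    simpa using this

/-- The augmentation of an invariant element is divisible by any common divisor of the lengths of
the orbits in its support. -/
lemma _root_.MulAction.dvd_linearCombination_one_of_invariant {N X : Type*} [Group N] [Finite N]
    [MulAction N X] (u : X →₀ ℤ) (hu : ∀ (g : N) x, u (g • x) = u x) (m : ℕ)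
    (hm : ∀ x, u x ≠ 0 → m ∣ Nat.card (orbit N x)) :
    (m : ℤ) ∣ linearCombination ℤ (fun _ : X => (1 : ℤ)) u := by
  classical
  -- Group the sum by orbits: an orbit contributes its length times the common coefficient.
  rw [linearCombination_apply, Finsupp.sum,
    ← Finset.sum_fiberwise_of_maps_to (t := u.support.image (Quotient.mk (orbitRel N X)))
      (g := Quotient.mk (orbitRel N X)) (fun x hx => Finset.mem_image_of_mem _ hx)]
  refine Finset.dvd_sum fun q hq => ?_
  obtain ⟨x, hx, rfl⟩ := Finset.mem_image.mp hq
  rw [Finsupp.mem_support_iff] at hx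
  have h1 : ∀ y ∈ u.support.filter (fun y => (⟦y⟧ : Quotient (orbitRel N X)) = ⟦x⟧),
      u y • (1 : ℤ) = u x := fun y hy => by
    obtain ⟨g, hg⟩ := Quotient.exact (Finset.mem_filter.mp hy).2
    simp only at hg
    rw [← hg, hu, smul_eq_mul, mul_one]
  have h2 : ((u.support.filter (fun y => (⟦y⟧ : Quotient (orbitRel N X)) = ⟦x⟧) : Finset X) : Set X)
      = orbit N x := by
    ext y
    simp only [Finset.coe_filter, Finsupp.mem_support_iff, Set.mem_ofPred_eq]
    constructor
    · rintro ⟨-, h⟩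
      exact Quotient.exact h
    · rintro h
      refine ⟨?_, Quotient.sound h⟩
      obtain ⟨g, rfl⟩ := h
      simp only
      rwa [hu]
  rw [Finset.sum_congr rfl h1, Finset.sum_const, nsmul_eq_mul]
  refine Dvd.dvd.mul_right ?_ _
  rw [Int.natCast_dvd_natCast, ← Set.ncard_coe_finset, h2]
  exact hm x hx

/-- Otherwise `M` is normal. Every point fixed by `M` has stabilizer exactly `M`, so its orbit has
length `M.index`, and this index would divide the augmentation 1 of an invariant element. -/
lemma normalizer_eq_of_isCoatom [Finite G] (D : AugmentationRetract G 𝓕 V E)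
    (h𝓕 : ∀ K, K ∈ 𝓕 ↔ K ≠ ⊤) {M : Subgroup G} (hM : IsCoatom M) :
    Subgroup.normalizer (M : Set G) = M := by
  rcases hM.le_iff.mp (Subgroup.le_normalizer (H := M)) with h | h
  swap
  · exact h
  exfalso
  obtain ⟨u, hu, hu1, hinv⟩ := D.exists_invariant ((h𝓕 M).mpr hM.1)
    (fun L hL hlt => absurd (hM.2 L hlt) ((h𝓕 L).mp hL))
  have := dvd_linearCombination_one_of_invariant (N := G) u
    (fun g x => hinv g (h ▸ Subgroup.mem_top g) x) M.index (fun x hx => by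
      have h1 : stabilizer G x = M := (hM.le_iff.mp (hu x hx)).resolve_left
        ((h𝓕 _).mp (D.stabilizer_mem x))
      rw [← h1, index_stabilizer]
      exact dvd_rfl)
  rw [hu1, Int.natCast_dvd] at this
  exact hM.1 (Subgroup.index_eq_one.mp (Nat.dvd_one.mp this))

lemma _root_.Subgroup.two_mul_card_le_of_lt [Finite G] {K L : Subgroup G} (h : K < L) :
    2 * Nat.card K ≤ Nat.card L := by
  obtain ⟨c, hc⟩ := Subgroup.card_dvd_of_le h.le
  have h1 : Nat.card L ≠ Nat.card K := fun he =>
    h.ne (Subgroup.eq_of_le_of_card_ge h.le he.le)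
  have h2 : 0 < Nat.card L := Nat.card_pos
  rcases c with _ | _ | c
  · simp at hc; omega
  · simp at hc; omega
  · rw [hc]; nlinarith

lemma _root_.MulAction.two_mul_card_orbit_le {N X : Type*} [Group N] [Finite N] [MulAction N X]
    {K : Subgroup N} {x : X} (h : K < stabilizer N x) :
    2 * (Nat.card K * Nat.card (orbit N x)) ≤ Nat.card N := by
  have h1 := Subgroup.two_mul_card_le_of_lt h
  have h2 : Nat.card (orbit N x) * Nat.card (stabilizer N x) = Nat.card N := by
    rw [← Nat.card_prod, Nat.card_congr (orbitProdStabilizerEquivGroup N x)]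
  nlinarith

/-- If the elements outside `K` have at most one fixed point, then at most one orbit has
stabilizers larger than `K`. -/
lemma _root_.MulAction.false_of_two_nonfree_orbits {N X : Type*} [Group N] [Finite N]
    [MulAction N X] {K : Subgroup N} {x y : X} (hxy : y ∉ orbit N x)
    (hK : ∀ n ∉ K, ∀ a ∈ orbit N x ∪ orbit N y, ∀ b ∈ orbit N x ∪ orbit N y,
      n • a = a → n • b = b → a = b)
    (hx : K < stabilizer N x) (hy : K < stabilizer N y) : False := by
  classical
  cases nonempty_fintype N
  have : Finite (orbit N x) := Set.finite_range _
  have : Fintype (orbit N x) := Fintype.ofFinite _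
  have : Finite (orbit N y) := Set.finite_range _
  have : Fintype (orbit N y) := Fintype.ofFinite _
  have burnside : ∀ z : X, [Fintype (orbit N z)] →
      ∑ n : N, Fintype.card (fixedBy (orbit N z) n) = Fintype.card N := by
    intro z _
    have : Fintype (Quotient (orbitRel N (orbit N z))) := Fintype.ofFinite _
    rw [sum_card_fixedBy_eq_card_orbits_mul_card_group]
    have h1 : Fintype.card (Quotient (orbitRel N (orbit N z))) = 1 := by
      rw [Fintype.card_eq_one_iff]
      refine ⟨⟦⟨z, mem_orbit_self z⟩⟧, fun q => ?_⟩
      induction q using Quotient.inductionOn with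
      | h w =>
        exact Quotient.sound (exists_smul_eq N (⟨z, mem_orbit_self z⟩ : orbit N z) w)
    rw [h1, one_mul]
  have hle : ∀ n : N, Fintype.card (fixedBy (orbit N x) n) + Fintype.card (fixedBy (orbit N y) n) ≤
      (if n ∈ K then Fintype.card (orbit N x) + Fintype.card (orbit N y) else 0) +
        if n ∈ K then 0 else 1 := by
    intro n
    split_ifs with hn
    · rw [add_zero]
      exact add_le_add (Fintype.card_subtype_le _) (Fintype.card_subtype_le _)
    · rw [← Fintype.card_sum, zero_add, Fintype.card_le_one_iff_subsingleton]
      have hv : ∀ z : X, ∀ a : fixedBy (orbit N z) n, n • (a : orbit N z).1 = a.1 := fun z a => by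
        exact congrArg Subtype.val a.2
      refine ⟨?_⟩
      rintro (a | a) (b | b)
      · have := hK n hn a.1 (Or.inl a.1.2) b.1 (Or.inl b.1.2) (hv _ a) (hv _ b)
        rw [Subtype.ext (Subtype.ext this)]
      · have := hK n hn a.1 (Or.inl a.1.2) b.1 (Or.inr b.1.2) (hv _ a) (hv _ b)
        refine absurd ?_ hxy
        have h1 := a.1.2
        rw [this] at h1
        rw [← orbit_eq_iff, ← orbit_eq_iff.mpr h1, orbit_eq_iff.mpr b.1.2]
      · have := hK n hn a.1 (Or.inr a.1.2) b.1 (Or.inl b.1.2) (hv _ a) (hv _ b)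
        refine absurd ?_ hxy
        have h1 := a.1.2
        rw [this] at h1
        rw [← orbit_eq_iff, ← orbit_eq_iff.mpr h1, orbit_eq_iff.mpr b.1.2]
      · have := hK n hn a.1 (Or.inr a.1.2) b.1 (Or.inr b.1.2) (hv _ a) (hv _ b)
        rw [Subtype.ext (Subtype.ext this)]
  -- Burnside for both orbits gives `2|N| ≤ |K|(|Nx| + |Ny|) + |N \ K|`. Both `|K||Nx|` and
  -- `|K||Ny|` are at most `|N|/2`, and `|N \ K| < |N|`, which is absurd.
  have hsum := Finset.sum_le_sum fun n (_ : n ∈ Finset.univ) => hle n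
  rw [Finset.sum_add_distrib, burnside, burnside, Finset.sum_add_distrib, ← Finset.sum_filter,
    Finset.sum_const, smul_eq_mul] at hsum
  have hKc : (Finset.univ.filter fun n => n ∈ K).card = Nat.card K := by
    rw [Nat.card_eq_fintype_card, Fintype.card_subtype]
  have hlt : (∑ n : N, if n ∈ K then 0 else 1) < Fintype.card N := by
    rw [Fintype.card_eq_sum_ones]
    exact Finset.sum_lt_sum (fun n _ => by split_ifs <;> simp)
      ⟨1, Finset.mem_univ _, by simp [K.one_mem]⟩
  have h1 := two_mul_card_orbit_le hx
  have h2 := two_mul_card_orbit_le hy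
  rw [hKc] at hsum
  rw [Nat.card_eq_fintype_card (α := N)] at h1 h2
  rw [Nat.card_eq_fintype_card (α := orbit N x)] at h1
  rw [Nat.card_eq_fintype_card (α := orbit N y)] at h2
  rw [mul_add] at hsum
  omega

/-- A bipartite graph with edge set `G ⧸ K` whose vertices have degree at least two contains a
cycle. -/
lemma _root_.MulAction.exists_cycle [Fintype G] {X : Type*} [MulAction G X] {K : Subgroup G}
    {x y : X} (hx : K < stabilizer G x) (hy : K < stabilizer G y) :
    ∃ a : G ⧸ K → ℤ, a ≠ 0 ∧ ∑ g : G, a g • single (g • x) (1 : ℤ) = 0 ∧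
      ∑ g : G, a g • single (g • y) (1 : ℤ) = 0 := by
  classical
  have : Fintype (G ⧸ K) := Fintype.ofFinite _
  have : Finite (orbit G x) := Set.finite_range _
  have : Fintype (orbit G x) := Fintype.ofFinite _
  have : Finite (orbit G y) := Set.finite_range _
  have : Fintype (orbit G y) := Fintype.ofFinite _
  let φ : ∀ z : X, (G ⧸ K → ℤ) →ₗ[ℤ] (orbit G z →₀ ℤ) := fun z =>
    ∑ g : G, (LinearMap.toSpanSingleton ℤ _ (single (g • (⟨z, mem_orbit_self z⟩ : orbit G z))
      (1 : ℤ))).comp (LinearMap.proj (g : G ⧸ K))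
  have hφ : ∀ z a, φ z a = ∑ g : G, a g • single (g • (⟨z, mem_orbit_self z⟩ : orbit G z)) 1 := by
    intro z a
    simp [φ]
  -- The vertices number at most `|G/K|`, so edges alone need not give a kernel by rank. The extra
  -- `ℤ` raises the source rank to `|G/K| + 1`; equality of the augmentations of the two components
  -- then shows that its coordinate vanishes on the kernel.
  let Φ : (G ⧸ K → ℤ) × ℤ →ₗ[ℤ] (orbit G x →₀ ℤ) × (orbit G y →₀ ℤ) :=
    (((φ x).comp (LinearMap.fst ℤ _ _)) + (LinearMap.toSpanSingleton ℤ _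
      (single (⟨x, mem_orbit_self x⟩ : orbit G x) (1 : ℤ))).comp (LinearMap.snd ℤ _ _)).prod
      ((φ y).comp (LinearMap.fst ℤ _ _))
  have hnot : ¬ Function.Injective Φ := by
    intro hinj
    have h1 := LinearMap.finrank_le_finrank_of_injective hinj
    rw [Module.finrank_prod, Module.finrank_prod, Module.finrank_finsupp_self,
      Module.finrank_finsupp_self, Module.finrank_fintype_fun_eq_card, Module.finrank_self] at h1
    have h2 := two_mul_card_orbit_le hx
    have h3 := two_mul_card_orbit_le hy
    have h4 := Subgroup.card_mul_index K
    rw [Subgroup.index, Nat.card_eq_fintype_card (α := G ⧸ K)] at h4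
    rw [Nat.card_eq_fintype_card (α := orbit G x), ← h4] at h2
    rw [Nat.card_eq_fintype_card (α := orbit G y), ← h4] at h3
    have h5 : 0 < Nat.card K := Nat.card_pos
    nlinarith
  rw [← LinearMap.ker_eq_bot, Submodule.eq_bot_iff] at hnot
  push Not at hnot
  obtain ⟨⟨a, n⟩, hker, hne⟩ := hnot
  rw [LinearMap.mem_ker, Prod.ext_iff] at hker
  obtain ⟨k1, k2⟩ := hker
  simp only [Φ, LinearMap.prod_apply, Function.prod, LinearMap.add_apply, LinearMap.comp_apply,
    LinearMap.fst_apply, LinearMap.snd_apply, hφ, LinearMap.toSpanSingleton_apply,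
    Prod.fst_zero, Prod.snd_zero] at k1 k2
  have hsum : ∑ g : G, a g = 0 := by
    have := congrArg (linearCombination ℤ (fun _ => (1 : ℤ))) k2
    simpa using this
  have hn : n = 0 := by
    have := congrArg (linearCombination ℤ (fun _ => (1 : ℤ))) k1
    simpa [hsum] using this
  subst hn
  rw [zero_smul, add_zero] at k1
  refine ⟨a, fun h => hne (by rw [h]; rfl), ?_, ?_⟩
  · have := congrArg (mapDomain Subtype.val) k1
    rw [mapDomain_finsetSum] at this
    simpa [mapDomain_smul] using this
  · have := congrArg (mapDomain Subtype.val) k2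
    rw [mapDomain_finsetSum] at this
    simpa [mapDomain_smul] using this

/-- Along a cycle the elements `d (g • x) (g • y)` sum to zero. Keeping only points of `E` with
stabilizer `K` leaves the terms with `g` in the normalizer; applying `r` and reading the coefficient
of `x` leaves those with `g ∈ K`. -/
lemma sum_eq_zero_of_cycle [Fintype G] (D : AugmentationRetract G 𝓕 V E) {K : Subgroup G}
    [DecidablePred (· ∈ K)] (hK : K ∈ 𝓕)
    (hL : ∀ L ∈ 𝓕, K < L → ∀ u v : V, L ≤ stabilizer G u → L ≤ stabilizer G v → u = v)
    {x y : V} (hx : K ≤ stabilizer G x) (hy : K ≤ stabilizer G y)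
    (hxN : ∀ w ∈ Subgroup.normalizer (K : Set G), w • x = x → w ∈ K)
    (hxy : ∀ w ∈ Subgroup.normalizer (K : Set G), w • y ≠ x) (b : G → ℤ)
    (hbx : ∑ g : G, b g • single (g • x) (1 : ℤ) = 0)
    (hby : ∑ g : G, b g • single (g • y) (1 : ℤ) = 0) :
    ∑ g : G, (if g ∈ K then b g else 0) = 0 := by
  classical
  have h1 : ∑ g : G, b g • D.d (g • x) (g • y) = 0 := by
    have hd : ∀ g : G, D.d (g • x) (g • y) = D.d (g • x) x - D.d (g • y) x := fun g => by
      rw [← D.d_add_d (g • x) (g • y) x]; abel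
    have hz : ∀ z : V, ∑ g : G, b g • single (g • z) (1 : ℤ) = 0 →
        ∑ g : G, b g • D.d (g • z) x = 0 := fun z h => by
      have := congrArg (linearCombination ℤ (fun v => D.d v x)) h
      simpa using this
    simp only [hd, smul_sub, Finset.sum_sub_distrib, hz x hbx, hz y hby, sub_zero]
  let N := Subgroup.normalizer (K : Set G)
  let p : E → Prop := fun e => stabilizer G e = K
  have h2 : ∀ g, (D.d (g • x) (g • y)).filter p =
      if g ∈ N then (D.d (g • x) (g • y)).filter p else 0 := by
    intro g
    split_ifs with hg
    · rfl
    · ext e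
      rw [filter_apply]
      split_ifs with he
      swap
      · rfl
      by_contra hne
      refine hg ?_
      -- The translate `g⁻¹ • e` occurs in `d x y`, so `K` fixes it; thus `gKg⁻¹ ≤ stabilizer G e =
      -- K`, with equality by finiteness.
      have hst : K ≤ stabilizer G (g⁻¹ • e) :=
        D.d_le K hK x y _ hx hy (by rw [← D.d_smul_eq]; exact hne)
      have hc : K.map (MulAut.conj g).toMonoidHom ≤ K := by
        have := Subgroup.map_mono (f := (MulAut.conj g).toMonoidHom) hst
        rw [← stabilizer_smul_eq_stabilizer_map_conj, smul_inv_smul] at this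
        exact this.trans_eq he
      have he2 := Subgroup.eq_of_le_of_card_ge hc (Nat.card_congr
        (Subgroup.equivMapOfInjective K (MulAut.conj g).toMonoidHom
          (MulAut.conj g).injective).toEquiv).le
      exact Subgroup.mem_normalizer_iff_map_conj_eq.mpr he2
  have h3 : ∑ g : G, b g • (if g ∈ N then single (g • x) (1 : ℤ) - single (g • y) 1 else 0) = 0 := by
    have := congrArg (fun z => linearCombination ℤ D.r (z.filter p)) h1
    simp only [filter_sum, filter_smul, map_sum, map_smul, filter_zero, map_zero] at this
    refine Eq.trans (Finset.sum_congr rfl fun g _ => ?_) this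
    rw [h2]
    split_ifs with hg
    · rw [D.r_d_filter hK hL (le_stabilizer_smul hx hg) (le_stabilizer_smul hy hg)]
    · rw [map_zero]
  have h4 := DFunLike.congr_fun h3 x
  rw [Finsupp.finsetSum_apply] at h4
  refine Eq.trans ?_ h4
  refine Finset.sum_congr rfl fun g _ => ?_
  by_cases hg : g ∈ N
  · rw [if_pos hg, Finsupp.smul_apply, Finsupp.sub_apply, single_apply, single_apply,
      if_neg (hxy g hg), sub_zero]
    by_cases hgK : g ∈ K
    · rw [if_pos hgK, if_pos (mem_stabilizer_iff.mp (hx hgK)), smul_eq_mul, mul_one]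
    · rw [if_neg hgK, if_neg fun h => hgK (hxN g hg h), smul_zero]
  · rw [if_neg hg, if_neg fun h => hg (Subgroup.le_normalizer h)]
    simp

/-- The cycle from `exists_cycle` can be translated so that any chosen edge becomes the trivial
coset; `sum_eq_zero_of_cycle` then says that `|K|` times its coefficient is zero. -/
lemma false_of_nonfree [Finite G] (D : AugmentationRetract G 𝓕 V E) {K : Subgroup G} (hK : K ∈ 𝓕)
    (hL : ∀ L ∈ 𝓕, K < L → ∀ u v : V, L ≤ stabilizer G u → L ≤ stabilizer G v → u = v)
    {x y : V} (hx : K < stabilizer G x) (hy : K < stabilizer G y)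
    (hxN : ∀ w ∈ Subgroup.normalizer (K : Set G), w • x = x → w ∈ K)
    (hxy : ∀ w ∈ Subgroup.normalizer (K : Set G), w • y ≠ x) : False := by
  classical
  cases nonempty_fintype G
  obtain ⟨a, ha, hax, hay⟩ := exists_cycle hx hy
  obtain ⟨q, hq⟩ := Function.ne_iff.mp ha
  induction q using QuotientGroup.induction_on with
  | H g₀ =>
    have htrans : ∀ z : V, ∑ g : G, a g • single (g • z) (1 : ℤ) = 0 →
        ∑ g : G, a ((g₀ * g : G) : G ⧸ K) • single (g • z) (1 : ℤ) = 0 := by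
      intro z hz
      have := congrArg (mapDomain (g₀⁻¹ • ·)) hz
      simp only [mapDomain_finsetSum, mapDomain_smul, mapDomain_single, mapDomain_zero] at this
      rw [← this]
      refine Fintype.sum_equiv (Equiv.mulLeft g₀) _ _ fun g => ?_
      simp [mul_smul]
    have h := D.sum_eq_zero_of_cycle hK hL hx.le hy.le hxN hxy
      (fun g => a ((g₀ * g : G) : G ⧸ K)) (htrans x hax) (htrans y hay)
    have h1 : ∀ g : G, (if g ∈ K then a ((g₀ * g : G) : G ⧸ K) else 0) =
        if g ∈ K then a (g₀ : G ⧸ K) else 0 := fun g => by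
      split_ifs with hg
      · rw [QuotientGroup.mk_mul_of_mem _ hg]
      · rfl
    rw [Finset.sum_congr rfl fun g _ => h1 g, ← Finset.sum_filter, Finset.sum_const, nsmul_eq_mul,
      mul_eq_zero] at h
    rcases h with h | h
    · rw [Nat.cast_eq_zero, Finset.card_eq_zero] at h
      have : (1 : G) ∈ Finset.univ.filter (· ∈ K) := by simp [K.one_mem]
      rw [h] at this
      exact absurd this (Finset.notMem_empty _)
    · exact hq h

end AugmentationRetract

/-! ### The conjugation action on maximal subgroups. -/

/-- The set of maximal subgroups of a group. -/
def MaximalSubgroup (G : Type*) [Group G] : Type _ := {M : Subgroup G // IsCoatom M}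

namespace MaximalSubgroup

variable {G : Type*} [Group G]

lemma mem_map_conj {M : Subgroup G} {g x : G} :
    x ∈ M.map (MulAut.conj g).toMonoidHom ↔ g⁻¹ * x * g ∈ M := by
  constructor
  · rintro ⟨y, hy, rfl⟩
    have : g⁻¹ * (g * y * g⁻¹) * g = y := by group
    change g⁻¹ * (g * y * g⁻¹) * g ∈ M
    rwa [this]
  · intro h
    refine ⟨_, h, ?_⟩
    change g * (g⁻¹ * x * g) * g⁻¹ = x
    group

/-- A group acts on its maximal subgroups by conjugation. -/
instance : MulAction G (MaximalSubgroup G) where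
  smul g M := ⟨M.1.map (MulAut.conj g).toMonoidHom,
    ((MulAut.conj g).mapSubgroup.isCoatom_iff M.1).mpr M.2⟩
  one_smul M := Subtype.ext <| by
    ext x
    refine mem_map_conj.trans ?_
    simp
  mul_smul g h M := Subtype.ext <| by
    ext x
    refine mem_map_conj.trans ((Iff.trans ?_ mem_map_conj.symm).trans mem_map_conj.symm)
    simp only [mul_inv_rev, mul_assoc]

lemma smul_eq_self_iff {g : G} {M : MaximalSubgroup G} :
    g • M = M ↔ g ∈ Subgroup.normalizer (M.1 : Set G) :=
  Subtype.ext_iff.trans Subgroup.mem_normalizer_iff_map_conj_eq.symm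

lemma stabilizer_eq (M : MaximalSubgroup G) :
    MulAction.stabilizer G M = Subgroup.normalizer (M.1 : Set G) :=
  Subgroup.ext fun _ => smul_eq_self_iff

lemma eq_of_le {M M' : MaximalSubgroup G} (h : M.1 ≤ M'.1) : M = M' :=
  Subtype.ext ((M.2.le_iff.mp h).resolve_left M'.2.1).symm

end MaximalSubgroup

/-! ### No retract exists for the proper subgroups of a nontrivial finite group. -/

namespace AugmentationRetract

open Finsupp MulAction

variable {G : Type*} [Group G] {𝓕 : Set (Subgroup G)} {V E : Type*} [MulAction G V] [MulAction G E]

theorem false_of_finite [Finite G] [Nontrivial G] (D : AugmentationRetract G 𝓕 V E)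
    (h𝓕 : ∀ K, K ∈ 𝓕 ↔ K ≠ ⊤) : False := by
  classical
  have hst : ∀ M : MaximalSubgroup G, stabilizer G M = M.1 := fun M => by
    rw [M.stabilizer_eq, D.normalizer_eq_of_isCoatom h𝓕 M.2]
  obtain ⟨a, ha⟩ := exists_equivariant_of_stabilizer_le (G := G) (X := MaximalSubgroup G) (Y := V)
    fun M => by
      rw [hst]
      exact D.exists_le _ ((h𝓕 _).mpr M.2.1)
  obtain ⟨b, hb⟩ := exists_equivariant_of_stabilizer_le (G := G) (X := V) (Y := MaximalSubgroup G)
    fun v => by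
      obtain ⟨M, hM, hle⟩ := (eq_top_or_exists_le_coatom (stabilizer G v)).resolve_left
        ((h𝓕 _).mp (D.stabilizer_mem v))
      exact ⟨⟨M, hM⟩, hle.trans_eq (hst ⟨M, hM⟩).symm⟩
  let D' := D.transfer a b ha hb (fun M => (hst M).symm ▸ (h𝓕 _).mpr M.2.1)
  have hfin : Finite (MaximalSubgroup G) := Subtype.finite
  -- A unique maximal subgroup would be normal, against self-normalization.
  have hex : Nonempty {p : MaximalSubgroup G × MaximalSubgroup G // p.1 ≠ p.2} := by
    obtain ⟨M, hM, -⟩ := (eq_top_or_exists_le_coatom (⊥ : Subgroup G)).resolve_left bot_ne_top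
    by_contra hempty
    refine hM.1 ?_
    rw [← D.normalizer_eq_of_isCoatom h𝓕 hM, eq_top_iff]
    intro g _
    rw [← MaximalSubgroup.smul_eq_self_iff (M := ⟨M, hM⟩)]
    by_contra hne
    exact hempty ⟨⟨(_, _), hne⟩⟩
  obtain ⟨⟨⟨c₁, c₂⟩, hc⟩, hmax⟩ := Finite.exists_max
    fun p : {p : MaximalSubgroup G × MaximalSubgroup G // p.1 ≠ p.2} =>
      Nat.card (p.1.1.1 ⊓ p.1.2.1 : Subgroup G)
  simp only at hc hmax
  set K : Subgroup G := c₁.1 ⊓ c₂.1 with hKdef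
  -- Maximality of the order of `K` enters here; it makes `K` isolating (`hL`).
  have hinf : ∀ M M' : MaximalSubgroup G, K ≤ M.1 → K ≤ M'.1 → M ≠ M' → M.1 ⊓ M'.1 = K :=
    fun M M' h h' hne => (Subgroup.eq_of_le_of_card_ge (le_inf h h') (hmax ⟨(M, M'), hne⟩)).symm
  have hK : K ∈ 𝓕 := (h𝓕 K).mpr fun h => c₁.2.1 (top_le_iff.mp (h ▸ inf_le_left))
  have hL : ∀ L ∈ 𝓕, K < L → ∀ u v : MaximalSubgroup G, L ≤ stabilizer G u →
      L ≤ stabilizer G v → u = v := by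
    intro L _ hlt u v hu hv
    rw [hst] at hu hv
    by_contra hne
    exact (hlt.trans_le (le_inf hu hv)).ne (hinf u v (hlt.le.trans hu) (hlt.le.trans hv) hne).symm
  let N := Subgroup.normalizer (K : Set G)
  have hlt : ∀ x y : MaximalSubgroup G, K ≤ x.1 → K ≤ y.1 → x ≠ y → K < stabilizer G x := by
    intro x y hx hy hne
    rw [hst]
    refine lt_of_le_of_ne hx fun h => hne (MaximalSubgroup.eq_of_le (h ▸ hy))
  have horb : ∀ x : MaximalSubgroup G, K ≤ x.1 → ∀ y ∈ orbit N x, K ≤ y.1 := by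
    rintro x hx _ ⟨n, rfl⟩
    rw [← hst] at hx ⊢
    exact le_stabilizer_smul hx n.2
  have key : ∀ x y : MaximalSubgroup G, K ≤ x.1 → K ≤ y.1 → y ∉ orbit N x →
      ¬ ∀ w ∈ N, w • x = x → w ∈ K := by
    intro x y hx hy hxy hfree
    have hne : x ≠ y := by
      rintro rfl
      exact hxy (mem_orbit_self x)
    refine D'.false_of_nonfree hK hL (hlt x y hx hy hne) (hlt y x hy hx hne.symm) hfree ?_
    rintro w hw h
    exact hxy (mem_orbit_symm.mp ⟨⟨w, hw⟩, h⟩)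
  have htrans : ∀ x y : MaximalSubgroup G, K ≤ x.1 → K ≤ y.1 → y ∈ orbit N x := by
    intro x y hx hy
    by_contra hxy
    have hyx : x ∉ orbit N y := fun h => hxy (mem_orbit_symm.mp h)
    have hltN : ∀ z : MaximalSubgroup G, K ≤ z.1 → (¬ ∀ w ∈ N, w • z = z → w ∈ K) →
        K.subgroupOf N < stabilizer N z := by
      intro z hz hnot
      push Not at hnot
      obtain ⟨w, hw, hwz, hwK⟩ := hnot
      rw [SetLike.lt_iff_le_and_exists]
      refine ⟨fun k hk => ?_, ⟨w, hw⟩, hwz, hwK⟩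
      rw [← hst] at hz
      exact hz hk
    refine false_of_two_nonfree_orbits hxy ?_ (hltN x hx (key x y hx hy hxy))
      (hltN y hy (key y x hy hx hyx))
    -- An element of `N` fixing two distinct maximal subgroups above `K` lies in both, since they
    -- are self-normalizing, hence in `K`.
    intro n hn p hp q hq hnp hnq
    have hKp : K ≤ p.1 := hp.elim (horb x hx p) (horb y hy p)
    have hKq : K ≤ q.1 := hq.elim (horb x hx q) (horb y hy q)
    by_contra hne
    refine hn ?_
    change (n : G) ∈ K
    rw [← hinf p q hKp hKq hne, ← hst, ← hst]
    exact ⟨hnp, hnq⟩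
  obtain ⟨u, hu, hu1, hinv⟩ := D'.exists_invariant hK hL
  have hdvd := dvd_linearCombination_one_of_invariant (N := N) u (fun g x => hinv g g.2 x)
    (Nat.card (orbit N c₁)) fun x hx => by
      have := hu x hx
      rw [hst] at this
      rw [orbit_eq_iff.mpr (htrans c₁ x inf_le_left this)]
  rw [hu1, Int.natCast_dvd, Int.natAbs_one, Nat.dvd_one, Nat.card_eq_one_iff_unique] at hdvd
  have := hdvd.1
  exact hc (congrArg Subtype.val (Subsingleton.elim
    (⟨c₁, mem_orbit_self c₁⟩ : orbit N c₁) ⟨c₂, htrans c₁ c₂ inf_le_left inf_le_right⟩))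

end AugmentationRetract

/-! ### Free modules over the orbit category and the augmentation. -/

namespace SubgroupFamily

variable {Γ : Type u} [Group Γ] {F : SubgroupFamily Γ}

open Opposite

/-- The free module over the orbit category on a family of objects. -/
noncomputable def freeModule {ι : Type u} (X : ι → F.OrbitCategory) : F.OrbitModule where
  obj A := AddCommGrpCat.of ((Σ i, (A.unop ⟶ X i)) →₀ ℤ)
  map φ := AddCommGrpCat.ofHom (Finsupp.mapDomain.addMonoidHom fun p => ⟨p.1, φ.unop ≫ p.2⟩)
  map_id A := by
    ext1
    refine Finsupp.addHom_ext fun p n => ?_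
    simp
  map_comp φ ψ := by
    ext1
    refine Finsupp.addHom_ext fun p n => ?_
    simp

namespace freeModule

variable {ι : Type u} {X : ι → F.OrbitCategory}

/-- The values of a free module are free abelian groups. -/
noncomputable def equivFinsupp (X : ι → F.OrbitCategory) (A : F.OrbitCategoryᵒᵖ) :
    (freeModule X).obj A ≃+ ((Σ i, (A.unop ⟶ X i)) →₀ ℤ) := AddEquiv.refl _

/-- The standard basis of a value of a free module. -/
noncomputable def gen {A : F.OrbitCategoryᵒᵖ} (p : Σ i, (A.unop ⟶ X i)) : (freeModule X).obj A :=
  (equivFinsupp X A).symm (Finsupp.single p 1)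

lemma equivFinsupp_gen {A : F.OrbitCategoryᵒᵖ} (p : Σ i, (A.unop ⟶ X i)) :
    equivFinsupp X A (gen p) = Finsupp.single p 1 := AddEquiv.apply_symm_apply _ _

lemma equivFinsupp_map {A B : F.OrbitCategoryᵒᵖ} (φ : A ⟶ B) (x : (freeModule X).obj A) :
    equivFinsupp X B ((freeModule X).map φ x) =
      (equivFinsupp X A x).mapDomain fun p => ⟨p.1, φ.unop ≫ p.2⟩ := rfl

lemma map_gen {A B : F.OrbitCategoryᵒᵖ} (φ : A ⟶ B) (p : Σ i, (A.unop ⟶ X i)) :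
    (freeModule X).map φ (gen p) = gen ⟨p.1, φ.unop ≫ p.2⟩ := by
  apply (equivFinsupp X B).injective
  rw [equivFinsupp_map, equivFinsupp_gen, equivFinsupp_gen, Finsupp.mapDomain_single]

lemma addHom_ext {A : F.OrbitCategoryᵒᵖ} {M : Type*} [AddCommGroup M]
    {f g : (freeModule X).obj A →+ M} (h : ∀ p, f (gen p) = g (gen p)) : f = g := by
  have : f.comp (equivFinsupp X A).symm.toAddMonoidHom =
      g.comp (equivFinsupp X A).symm.toAddMonoidHom :=
    Finsupp.addHom_ext' fun p => AddMonoidHom.ext_int (h p)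
  ext x
  have := DFunLike.congr_fun this (equivFinsupp X A x)
  simpa using this

/-- The components of `desc`. -/
noncomputable def descHom (N : F.OrbitModule) (z : ∀ i, N.obj (op (X i))) (A : F.OrbitCategoryᵒᵖ) :
    (freeModule X).obj A →+ N.obj A :=
  AddMonoidHom.comp (Finsupp.liftAddHom fun p : Σ i, (A.unop ⟶ X i) =>
    zmultiplesHom (N.obj A) (N.map p.2.op (z p.1))) (equivFinsupp X A : _ →+ _)

lemma descHom_gen (N : F.OrbitModule) (z : ∀ i, N.obj (op (X i))) (A : F.OrbitCategoryᵒᵖ)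
    (p : Σ i, (A.unop ⟶ X i)) : descHom N z A (gen p) = N.map p.2.op (z p.1) := by
  rw [descHom, AddMonoidHom.comp_apply, AddMonoidHom.coe_coe, equivFinsupp_gen]
  simp

/-- The morphism from a free module which is determined by the images of the generators. -/
noncomputable def desc (N : F.OrbitModule) (z : ∀ i, N.obj (op (X i))) : freeModule X ⟶ N where
  app A := AddCommGrpCat.ofHom (descHom N z A)
  naturality A B φ := by
    ext1
    refine addHom_ext fun p => ?_
    change descHom N z B ((freeModule X).map φ (gen p)) = N.map φ (descHom N z A (gen p))
    rw [map_gen, descHom_gen, descHom_gen, op_comp, Functor.map_comp]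
    rfl

lemma desc_app_gen (N : F.OrbitModule) (z : ∀ i, N.obj (op (X i))) (A : F.OrbitCategoryᵒᵖ)
    (p : Σ i, (A.unop ⟶ X i)) :
    (desc N z).app A (gen p) = N.map p.2.op (z p.1) := descHom_gen N z A p

lemma hom_ext {N : F.OrbitModule} {f g : freeModule X ⟶ N}
    (h : ∀ i, f.app (op (X i)) (gen ⟨i, 𝟙 _⟩) = g.app (op (X i)) (gen ⟨i, 𝟙 _⟩)) : f = g := by
  ext A : 3
  refine addHom_ext fun p => ?_
  have h1 := congrArg (N.map p.2.op) (h p.1)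
  rw [← NatTrans.naturality_apply, ← NatTrans.naturality_apply, map_gen] at h1
  simpa using h1

/-- By Yoneda a map out of a free module is a choice of elements at the objects `X i`, and these
lift through a pointwise surjection. -/
instance : Projective (freeModule X) where
  factors {N N'} f e he := by
    have hs : ∀ A, Function.Surjective (e.app A) := fun A => by
      rw [← AddCommGrpCat.epi_iff_surjective]
      infer_instance
    choose z hz using fun i => hs (op (X i)) (f.app (op (X i)) (gen ⟨i, 𝟙 _⟩))
    refine ⟨desc _ z, hom_ext fun i => ?_⟩
    rw [NatTrans.comp_app, ConcreteCategory.comp_apply, desc_app_gen, ← hz]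
    simp

/-- The free module on all elements of a given module. -/
noncomputable abbrev cover (N : F.OrbitModule) : F.OrbitModule :=
  freeModule (ι := Σ X : F.OrbitCategory, N.obj (op X)) fun j => j.1

/-- Every module is a quotient of a free one. -/
noncomputable def coverHom (N : F.OrbitModule) : cover N ⟶ N := desc N fun j => j.2

instance (N : F.OrbitModule) : Epi (coverHom N) := by
  rw [NatTrans.epi_iff_epi_app]
  intro A
  rw [AddCommGrpCat.epi_iff_surjective]
  intro x
  refine ⟨gen ⟨⟨A.unop, x⟩, 𝟙 _⟩, ?_⟩
  rw [coverHom, desc_app_gen]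
  simp

end freeModule

/-- The values of the constant module. -/
noncomputable def constantModuleEquiv (F : SubgroupFamily Γ) (A : F.OrbitCategoryᵒᵖ) :
    F.constantModule.obj A ≃+ ℤ := (AddEquiv.ulift : ULift.{u} ℤ ≃+ ℤ)

lemma constantModuleEquiv_map {A B : F.OrbitCategoryᵒᵖ} (φ : A ⟶ B) (x : F.constantModule.obj A) :
    F.constantModuleEquiv B (F.constantModule.map φ x) = F.constantModuleEquiv A x := rfl

/-- The augmentation from the free module on all objects to the constant module. -/
noncomputable def augmentation (F : SubgroupFamily Γ) :
    freeModule (F := F) (fun X : F.OrbitCategory => X) ⟶ F.constantModule :=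
  freeModule.desc F.constantModule fun X => (F.constantModuleEquiv (op X)).symm 1

lemma constantModuleEquiv_augmentation_gen (A : F.OrbitCategoryᵒᵖ) (p : Σ X, (A.unop ⟶ X)) :
    F.constantModuleEquiv A ((augmentation F).app A (freeModule.gen p)) = 1 := by
  rw [augmentation, freeModule.desc_app_gen]
  exact (constantModuleEquiv_map _ _).trans (AddEquiv.apply_symm_apply _ _)

lemma augmentation_app_eq_zero_iff (A : F.OrbitCategoryᵒᵖ)
    (x : (freeModule (F := F) (fun X : F.OrbitCategory => X)).obj A) :
    (augmentation F).app A x = 0 ↔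
      Finsupp.linearCombination ℤ (fun _ => (1 : ℤ)) (freeModule.equivFinsupp _ A x) = 0 := by
  have : (F.constantModuleEquiv A : _ →+ ℤ).comp ((augmentation F).app A).hom =
      (Finsupp.linearCombination ℤ (fun _ => (1 : ℤ))).toAddMonoidHom.comp
        (freeModule.equivFinsupp (fun X : F.OrbitCategory => X) A :
          (freeModule (F := F) fun X : F.OrbitCategory => X).obj A →+
            ((Σ X : F.OrbitCategory, (A.unop ⟶ X)) →₀ ℤ)) := by
    refine freeModule.addHom_ext fun p => (constantModuleEquiv_augmentation_gen A p).trans ?_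
    rw [AddMonoidHom.comp_apply, AddMonoidHom.coe_coe, freeModule.equivFinsupp_gen]
    simp
  have h := DFunLike.congr_fun this x
  rw [← (F.constantModuleEquiv A).map_eq_zero_iff]
  exact Eq.congr_left h

instance : Epi (augmentation F) := by
  rw [NatTrans.epi_iff_epi_app]
  intro A
  rw [AddCommGrpCat.epi_iff_surjective]
  intro x
  refine ⟨F.constantModuleEquiv A x • freeModule.gen ⟨A.unop, 𝟙 _⟩, ?_⟩
  apply (F.constantModuleEquiv A).injective
  rw [map_zsmul, map_zsmul, constantModuleEquiv_augmentation_gen]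
  simp

/-- Dimension shifting along the short exact sequence with projective middle term. -/
lemma projective_kernel_augmentation (h : F.cohomologicalDimension = 1) :
    Projective (Limits.kernel (augmentation F)) := by
  have h1 : HasProjectiveDimensionLE F.constantModule 1 :=
    (projectiveDimension_le_iff _ 1).mp h.le
  let S := ShortComplex.mk (Limits.kernel.ι (augmentation F)) (augmentation F)
    (Limits.kernel.condition _)
  have hS : S.ShortExact :=
    { exact := ShortComplex.exact_kernel _ }
  rw [projective_iff_hasProjectiveDimensionLT_one]
  exact (hS.hasProjectiveDimensionLT_X₃_iff 0 inferInstance).mp h1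

lemma exact_kernel_augmentation (A : F.OrbitCategoryᵒᵖ)
    (x : (freeModule (F := F) (fun X : F.OrbitCategory => X)).obj A) :
    (augmentation F).app A x = 0 ↔ ∃ y, (Limits.kernel.ι (augmentation F)).app A y = x := by
  have hS : (ShortComplex.mk (Limits.kernel.ι (augmentation F)) (augmentation F)
      (Limits.kernel.condition _)).Exact := ShortComplex.exact_kernel _
  have := hS.map ((evaluation _ _).obj A)
  rw [ShortComplex.ab_exact_iff_function_exact] at this
  exact this x

lemma kernel_augmentation_app_injective (A : F.OrbitCategoryᵒᵖ) :
    Function.Injective ((Limits.kernel.ι (augmentation F)).app A) := by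
  rw [← AddCommGrpCat.mono_iff_injective]
  infer_instance

end SubgroupFamily

/-! ### Values of free modules as formal sums of fixed points of a `Γ`-set. -/

namespace SubgroupFamily

variable {Γ : Type u} [Group Γ] {F : SubgroupFamily Γ}

open Opposite MulAction

lemma mk_smul_one_eq (H : Subgroup Γ) (g : Γ) : g • ((1 : Γ) : Γ ⧸ H) = (g : Γ ⧸ H) := by
  rw [Quotient.smul_coe, smul_eq_mul, mul_one]

/-- The coset of the identity is fixed by `H`. -/
lemma smul_one_of_mem {H : Subgroup Γ} {g : Γ} (hg : g ∈ H) :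
    g • ((1 : Γ) : Γ ⧸ H) = ((1 : Γ) : Γ ⧸ H) := by
  rw [mk_smul_one_eq, eq_comm, QuotientGroup.eq]
  simpa using hg

/-- The equivariant map `Γ ⧸ H → X` given by a point of `X` fixed by `H`. -/
def homOfLeStabilizer {X : Type*} [MulAction Γ X] {H : Subgroup Γ} {x : X}
    (h : H ≤ stabilizer Γ x) : (Γ ⧸ H) →[Γ] X where
  toFun q := Quotient.liftOn' q (fun g => g • x) fun a b hab => by
    have := h (QuotientGroup.leftRel_apply.mp hab)
    rw [mem_stabilizer_iff, mul_smul, inv_smul_eq_iff] at this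
    exact this.symm
  map_smul' g q := by
    induction q using QuotientGroup.induction_on with
    | H a => exact mul_smul g a x

lemma homOfLeStabilizer_one {X : Type*} [MulAction Γ X] {H : Subgroup Γ} {x : X}
    (h : H ≤ stabilizer Γ x) : homOfLeStabilizer h ((1 : Γ) : Γ ⧸ H) = x := one_smul Γ x

/-- The image of the coset of the identity under a morphism of the orbit category. -/
def OrbitCategory.atOne {A B : F.OrbitCategory} (f : A ⟶ B) : Γ ⧸ B.subgroup :=
  (show (Γ ⧸ A.subgroup) →[Γ] (Γ ⧸ B.subgroup) from f) ((1 : Γ) : Γ ⧸ A.subgroup)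

namespace OrbitCategory

lemma atOne_injective {A B : F.OrbitCategory} {f g : A ⟶ B} (h : atOne f = atOne g) : f = g := by
  refine MulActionHom.ext fun q => ?_
  induction q using QuotientGroup.induction_on with
  | H a =>
    rw [← mk_smul_one_eq, map_smul, map_smul]
    exact congrArg (a • ·) h

lemma le_stabilizer_atOne {A B : F.OrbitCategory} (f : A ⟶ B) :
    A.subgroup ≤ stabilizer Γ (atOne f) := fun a ha => by
  rw [mem_stabilizer_iff, atOne, ← map_smul, smul_one_of_mem ha]

lemma exists_atOne_eq {A B : F.OrbitCategory} {x : Γ ⧸ B.subgroup}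
    (h : A.subgroup ≤ stabilizer Γ x) : ∃ f : A ⟶ B, atOne f = x :=
  ⟨homOfLeStabilizer h, homOfLeStabilizer_one h⟩

lemma atOne_comp {A B C : F.OrbitCategory} (f : A ⟶ B) (f' : B ⟶ C) {g : Γ}
    (h : atOne f = (g : Γ ⧸ B.subgroup)) : atOne (f ≫ f') = g • atOne f' := by
  change (show (Γ ⧸ B.subgroup) →[Γ] (Γ ⧸ C.subgroup) from f') (atOne f) = _
  rw [h, ← mk_smul_one_eq, map_smul]
  rfl

end OrbitCategory

lemma bot_mem (F : SubgroupFamily Γ) : ⊥ ∈ F :=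
  F.mem_of_le _ F.nonempty.choose_spec _ bot_le

/-- The object `Γ ⧸ ⊥` of the orbit category. -/
def orbitBot (F : SubgroupFamily Γ) : F.OrbitCategory := ⟨⊥, F.bot_mem⟩

namespace freeModule

variable {ι : Type u} {X : ι → F.OrbitCategory}

/-- The `Γ`-set whose fixed points form a basis of the free module. -/
abbrev Points (X : ι → F.OrbitCategory) : Type u := Σ i, Γ ⧸ (X i).subgroup

/-- A basis element of a free module as a point. -/
def point {A : F.OrbitCategory} (p : Σ i, (A ⟶ X i)) : Points X := ⟨p.1, OrbitCategory.atOne p.2⟩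

lemma point_injective {A : F.OrbitCategory} :
    Function.Injective (point : (Σ i, (A ⟶ X i)) → Points X) := by
  rintro ⟨i, f⟩ ⟨j, f'⟩ h
  obtain rfl : i = j := congrArg Sigma.fst h
  exact congrArg (Sigma.mk i) (OrbitCategory.atOne_injective (eq_of_heq (Sigma.mk.inj h).2))

lemma le_stabilizer_mk {H : Subgroup Γ} {i : ι} {x : Γ ⧸ (X i).subgroup} :
    H ≤ stabilizer Γ (⟨i, x⟩ : Points X) ↔ H ≤ stabilizer Γ x := by
  refine forall₂_congr fun a _ => ?_
  rw [mem_stabilizer_iff, mem_stabilizer_iff]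
  constructor
  · intro h
    exact eq_of_heq (Sigma.mk.inj h).2
  · intro h
    exact Sigma.ext rfl (heq_of_eq h)

lemma le_stabilizer_point {A : F.OrbitCategory} (p : Σ i, (A ⟶ X i)) :
    A.subgroup ≤ stabilizer Γ (point p) :=
  le_stabilizer_mk.mpr (OrbitCategory.le_stabilizer_atOne p.2)

lemma exists_point_eq {A : F.OrbitCategory} {v : Points X} (h : A.subgroup ≤ stabilizer Γ v) :
    ∃ p : Σ i, (A ⟶ X i), point p = v := by
  obtain ⟨i, x⟩ := v
  obtain ⟨f, rfl⟩ := OrbitCategory.exists_atOne_eq (le_stabilizer_mk.mp h)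
  exact ⟨⟨i, f⟩, rfl⟩

lemma point_comp {A B : F.OrbitCategory} (φ : A ⟶ B) {g : Γ}
    (h : OrbitCategory.atOne φ = (g : Γ ⧸ B.subgroup)) (p : Σ i, (B ⟶ X i)) :
    point (⟨p.1, φ ≫ p.2⟩ : Σ i, (A ⟶ X i)) = g • point p :=
  Sigma.ext rfl (heq_of_eq (OrbitCategory.atOne_comp φ p.2 h))

lemma stabilizer_mem (v : Points X) : stabilizer Γ v ∈ F.carrier := by
  obtain ⟨i, x⟩ := v
  induction x using QuotientGroup.induction_on with
  | H g =>
    refine F.mem_of_le _ (F.conj_mem _ (X i).mem g) _ fun a ha => ?_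
    have h : a • ((g : Γ) : Γ ⧸ (X i).subgroup) = g := eq_of_heq (Sigma.mk.inj ha).2
    rw [Quotient.smul_coe, eq_comm, QuotientGroup.eq] at h
    refine ⟨_, h, ?_⟩
    change g * (g⁻¹ * (a * g)) * g⁻¹ = a
    group

/-- The elements of a free module as formal sums of points. -/
noncomputable def toPoints (X : ι → F.OrbitCategory) (A : F.OrbitCategory) :
    (freeModule X).obj (op A) →+ (Points X →₀ ℤ) :=
  AddMonoidHom.comp (Finsupp.mapDomain.addMonoidHom (point (A := A) (X := X)))
    (equivFinsupp X (op A) : (freeModule X).obj (op A) →+ ((Σ i, (A ⟶ X i)) →₀ ℤ))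

lemma toPoints_apply {A : F.OrbitCategory} (x : (freeModule X).obj (op A)) :
    toPoints X A x = (equivFinsupp X (op A) x).mapDomain point := rfl

lemma toPoints_gen {A : F.OrbitCategory} (p : Σ i, (A ⟶ X i)) :
    toPoints X A (gen p) = Finsupp.single (point p) 1 := by
  rw [toPoints_apply, equivFinsupp_gen, Finsupp.mapDomain_single]

lemma le_stabilizer_of_toPoints_ne_zero {A : F.OrbitCategory} {x : (freeModule X).obj (op A)}
    {v : Points X} (h : toPoints X A x v ≠ 0) : A.subgroup ≤ stabilizer Γ v := by
  obtain ⟨p, -, rfl⟩ := AugmentationRetract.exists_of_mapDomain_ne_zero h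
  exact le_stabilizer_point p

lemma toPoints_map {A B : F.OrbitCategory} (φ : A ⟶ B) {g : Γ}
    (h : OrbitCategory.atOne φ = (g : Γ ⧸ B.subgroup)) (x : (freeModule X).obj (op B)) :
    toPoints X A ((freeModule X).map φ.op x) = (toPoints X B x).mapDomain (g • ·) := by
  rw [toPoints_apply, equivFinsupp_map, toPoints_apply, ← Finsupp.mapDomain_comp,
    ← Finsupp.mapDomain_comp]
  congr 1
  funext p
  exact point_comp φ h p

lemma linearCombination_toPoints {A : F.OrbitCategory} (x : (freeModule X).obj (op A)) :
    Finsupp.linearCombination ℤ (fun _ => (1 : ℤ)) (toPoints X A x) =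
      Finsupp.linearCombination ℤ (fun _ => (1 : ℤ)) (equivFinsupp X (op A) x) :=
  AugmentationRetract.linearCombination_one_mapDomain _ _

/-- The basis element of a free module at `Γ ⧸ ⊥` which corresponds to a point. -/
noncomputable def ofPoint (v : Points X) : Σ i, (F.orbitBot ⟶ X i) :=
  (exists_point_eq (A := F.orbitBot) (v := v) bot_le).choose

lemma point_ofPoint (v : Points X) : point (ofPoint v) = v :=
  (exists_point_eq (A := F.orbitBot) (v := v) bot_le).choose_spec

end freeModule

end SubgroupFamily

/-! ### From cohomological dimension one to an augmentation retract. -/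

namespace SubgroupFamily

variable {Γ : Type u} [Group Γ] {F : SubgroupFamily Γ}

open Opposite MulAction freeModule

/-- A family of objects which contains every object once. -/
abbrev allObjects (F : SubgroupFamily Γ) : F.OrbitCategory → F.OrbitCategory := fun X => X

section

variable {ι : Type u} {X : ι → F.OrbitCategory} (s : Limits.kernel (augmentation F) ⟶ freeModule X)
  (π : freeModule X ⟶ Limits.kernel (augmentation F))

lemma exists_ι_eq_gen_sub_gen {A : F.OrbitCategory} (p q : Σ X, (A ⟶ allObjects F X)) :
    ∃ y, (Limits.kernel.ι (augmentation F)).app (op A) y = gen p - gen q := by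
  rw [← exact_kernel_augmentation, augmentation_app_eq_zero_iff, map_sub, equivFinsupp_gen,
    equivFinsupp_gen, map_sub]
  simp

/-- The difference of two basis elements, as an element of the kernel of the augmentation. -/
noncomputable def kernelDiff {A : F.OrbitCategory} (p q : Σ X, (A ⟶ allObjects F X)) :
    (Limits.kernel (augmentation F)).obj (op A) :=
  (exists_ι_eq_gen_sub_gen p q).choose

lemma ι_kernelDiff {A : F.OrbitCategory} (p q : Σ X, (A ⟶ allObjects F X)) :
    (Limits.kernel.ι (augmentation F)).app (op A) (kernelDiff p q) = gen p - gen q :=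
  (exists_ι_eq_gen_sub_gen p q).choose_spec

lemma kernelDiff_add {A : F.OrbitCategory} (p q t : Σ X, (A ⟶ allObjects F X)) :
    kernelDiff p q + kernelDiff q t = kernelDiff p t := by
  apply kernel_augmentation_app_injective
  rw [map_add, ι_kernelDiff, ι_kernelDiff, ι_kernelDiff]
  abel

lemma map_kernelDiff {A B : F.OrbitCategory} (φ : A ⟶ B) (p q : Σ X, (B ⟶ allObjects F X)) :
    (Limits.kernel (augmentation F)).map φ.op (kernelDiff p q) =
      kernelDiff ⟨p.1, φ ≫ p.2⟩ ⟨q.1, φ ≫ q.2⟩ := by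
  apply kernel_augmentation_app_injective
  rw [ι_kernelDiff, NatTrans.naturality_apply, ι_kernelDiff, map_sub, map_gen, map_gen]
  rfl

/-- The first component of the augmentation retract obtained from a splitting. -/
noncomputable def diffPoints (v w : Points (allObjects F)) : Points X →₀ ℤ :=
  toPoints X F.orbitBot (s.app (op F.orbitBot) (kernelDiff (ofPoint v) (ofPoint w)))

lemma exists_atOne_eq_coe (A : F.OrbitCategory) (g : Γ) :
    ∃ φ : F.orbitBot ⟶ A, OrbitCategory.atOne φ = (g : Γ ⧸ A.subgroup) :=
  OrbitCategory.exists_atOne_eq (A := F.orbitBot) bot_le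

/-- Naturality along the map `Γ ⧸ ⊥ → Γ ⧸ A` sending the trivial coset to `g`. It yields both
equivariance (`A = Γ ⧸ ⊥`) and the fact that `diffPoints` on points fixed by a member of `F` can be
computed at the corresponding object (`g = 1`). -/
lemma diffPoints_smul_point {A : F.OrbitCategory} (p q : Σ X, (A ⟶ allObjects F X)) (g : Γ) :
    diffPoints s (g • point p) (g • point q) =
      (toPoints X A (s.app (op A) (kernelDiff p q))).mapDomain (g • ·) := by
  obtain ⟨φ, hφ⟩ := exists_atOne_eq_coe A g
  rw [← toPoints_map φ hφ, ← NatTrans.naturality_apply, map_kernelDiff, diffPoints]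
  congr 3
  · apply point_injective
    rw [point_ofPoint, point_comp φ hφ]
  · apply point_injective
    rw [point_ofPoint, point_comp φ hφ]

lemma diffPoints_point {A : F.OrbitCategory} (p q : Σ X, (A ⟶ allObjects F X)) :
    diffPoints s (point p) (point q) = toPoints X A (s.app (op A) (kernelDiff p q)) := by
  have := diffPoints_smul_point s p q 1
  rw [one_smul, one_smul] at this
  rw [this]
  simp only [one_smul]
  exact Finsupp.mapDomain_id

/-- The second component of the augmentation retract obtained from a splitting. -/
noncomputable def retractPoints (e : Points X) : Points (allObjects F) →₀ ℤ :=
  toPoints (allObjects F) F.orbitBot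
    ((π ≫ Limits.kernel.ι (augmentation F)).app (op F.orbitBot) (gen (ofPoint e)))

lemma retractPoints_smul_point {A : F.OrbitCategory} (p : Σ i, (A ⟶ X i)) (g : Γ) :
    retractPoints π (g • point p) =
      (toPoints (allObjects F) A ((π ≫ Limits.kernel.ι (augmentation F)).app (op A)
        (gen p))).mapDomain (g • ·) := by
  obtain ⟨φ, hφ⟩ := exists_atOne_eq_coe A g
  rw [← toPoints_map φ hφ, ← NatTrans.naturality_apply, map_gen, retractPoints]
  congr 3
  apply point_injective
  rw [point_ofPoint]
  exact (point_comp φ hφ p).symm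

lemma retractPoints_point {A : F.OrbitCategory} (p : Σ i, (A ⟶ X i)) :
    retractPoints π (point p) = toPoints (allObjects F) A
      ((π ≫ Limits.kernel.ι (augmentation F)).app (op A) (gen p)) := by
  have := retractPoints_smul_point π p 1
  rw [one_smul] at this
  rw [this]
  simp only [one_smul]
  exact Finsupp.mapDomain_id

lemma linearCombination_retractPoints {A : F.OrbitCategory} (x : (freeModule X).obj (op A)) :
    Finsupp.linearCombination ℤ (retractPoints π) (toPoints X A x) =
      toPoints (allObjects F) A ((π ≫ Limits.kernel.ι (augmentation F)).app (op A) x) := by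
  have : (Finsupp.linearCombination ℤ (retractPoints π)).toAddMonoidHom.comp (toPoints X A) =
      (toPoints (allObjects F) A).comp ((π ≫ Limits.kernel.ι (augmentation F)).app (op A)).hom := by
    refine freeModule.addHom_ext fun p => ?_
    refine Eq.trans ?_ (retractPoints_point π p)
    change Finsupp.linearCombination ℤ (retractPoints π) (toPoints X A (gen p)) = _
    rw [toPoints_gen]
    simp
  exact DFunLike.congr_fun this x

lemma linearCombination_diffPoints (hs : s ≫ π = 𝟙 _) (v w : Points (allObjects F)) :
    Finsupp.linearCombination ℤ (retractPoints π) (diffPoints s v w) =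
      Finsupp.single v 1 - Finsupp.single w 1 := by
  rw [diffPoints, linearCombination_retractPoints, NatTrans.comp_app, ConcreteCategory.comp_apply]
  have h : π.app (op F.orbitBot) (s.app (op F.orbitBot) (kernelDiff (ofPoint v) (ofPoint w))) =
      kernelDiff (ofPoint v) (ofPoint w) := by
    rw [← ConcreteCategory.comp_apply, ← NatTrans.comp_app, hs]
    rfl
  rw [h, ι_kernelDiff, map_sub, toPoints_gen, toPoints_gen, point_ofPoint, point_ofPoint]

/-- A splitting of the kernel of the augmentation from a free module gives an augmentation
retract. -/
noncomputable def augmentationRetract (hs : s ≫ π = 𝟙 _) :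
    AugmentationRetract Γ F.carrier (Points (allObjects F)) (Points X) where
  d := diffPoints s
  r := retractPoints π
  d_add_d u v w := by
    rw [diffPoints, diffPoints, diffPoints, ← map_add, ← map_add, kernelDiff_add]
  d_smul g u v e := by
    have := diffPoints_smul_point s (ofPoint u) (ofPoint v) g
    rw [← diffPoints_point, point_ofPoint, point_ofPoint] at this
    rw [this, Finsupp.mapDomain_apply (MulAction.injective g)]
  r_smul g e v := by
    have := retractPoints_smul_point π (ofPoint e) g
    rw [← retractPoints_point, point_ofPoint] at this
    rw [this, Finsupp.mapDomain_apply (MulAction.injective g)]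
  d_le K hK u v e hu hv he := by
    obtain ⟨p, rfl⟩ := exists_point_eq (A := ⟨K, hK⟩) hu
    obtain ⟨q, rfl⟩ := exists_point_eq (A := ⟨K, hK⟩) hv
    rw [diffPoints_point] at he
    exact le_stabilizer_of_toPoints_ne_zero he
  r_le e v h := by
    -- The stabilizer of `e` is itself in `F`, so `e` is a basis element at that object, and its
    -- image there involves only points fixed by that stabilizer.
    obtain ⟨p, hp⟩ := exists_point_eq (A := ⟨_, stabilizer_mem e⟩) (v := e) le_rfl
    rw [← hp, retractPoints_point] at h
    exact le_stabilizer_of_toPoints_ne_zero h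
  r_sum e := by
    rw [retractPoints, linearCombination_toPoints, ← augmentation_app_eq_zero_iff,
      exact_kernel_augmentation]
    exact ⟨_, rfl⟩
  r_d := linearCombination_diffPoints s π hs
  stabilizer_mem := stabilizer_mem
  stabilizer_mem' := stabilizer_mem
  exists_le K hK := ⟨_, le_stabilizer_point
    (⟨⟨K, hK⟩, 𝟙 _⟩ : Σ X, ((⟨K, hK⟩ : F.OrbitCategory) ⟶ allObjects F X))⟩

end

lemma nonempty_augmentationRetract_of_cohomologicalDimension (h : F.cohomologicalDimension = 1) :
    ∃ (V E : Type u) (_ : MulAction Γ V) (_ : MulAction Γ E),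
      Nonempty (AugmentationRetract Γ F.carrier V E) := by
  have := projective_kernel_augmentation h
  exact ⟨_, _, _, _, ⟨augmentationRetract
    (Projective.factorThru (𝟙 _) (coverHom (Limits.kernel (augmentation F))))
    (coverHom _) (Projective.factorThru_comp _ _)⟩⟩

end SubgroupFamily

/-! ### One-dimensional CW complexes: edges, height functions and chains. -/

namespace OneDimensionalCW

open Topology Metric Set

variable {X : Type u} [TopologicalSpace X] (cw : CWComplex (Set.univ : Set X))

/-- A vertex as a point of the space. -/
noncomputable def pt (i : cw.cell 0) : X := cw.map 0 i 0

/-- The parametrization of an edge. -/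
noncomputable def seg (e : cw.cell 1) (t : ℝ) : X := cw.map 1 e fun _ => t

lemma const_mem_closedBall {t : ℝ} (ht : t ∈ Icc (-1 : ℝ) 1) :
    (fun _ => t : Fin 1 → ℝ) ∈ closedBall (0 : Fin 1 → ℝ) 1 := by
  rw [mem_closedBall_zero_iff, pi_norm_le_iff_of_nonneg zero_le_one]
  exact fun _ => abs_le.mpr ht

lemma const_mem_ball {t : ℝ} (ht : t ∈ Ioo (-1 : ℝ) 1) :
    (fun _ => t : Fin 1 → ℝ) ∈ ball (0 : Fin 1 → ℝ) 1 := by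
  rw [mem_ball_zero_iff, pi_norm_lt_iff zero_lt_one]
  exact fun _ => abs_lt.mpr ht

lemma exists_eq_const_of_mem_closedBall {x : Fin 1 → ℝ} (hx : x ∈ closedBall (0 : Fin 1 → ℝ) 1) :
    ∃ t ∈ Icc (-1 : ℝ) 1, x = fun _ => t := by
  rw [mem_closedBall_zero_iff, pi_norm_le_iff_of_nonneg zero_le_one] at hx
  exact ⟨x 0, abs_le.mp (hx 0), funext fun i => by rw [Subsingleton.elim i 0]⟩

lemma continuousOn_seg (e : cw.cell 1) : ContinuousOn (seg cw e) (Icc (-1) 1) :=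
  (cw.continuousOn 1 e).comp (by fun_prop) fun _ ht => const_mem_closedBall ht

variable {cw}

lemma pt_injective : Function.Injective (pt cw) := by
  intro i j h
  by_contra hne
  have := cw.pairwiseDisjoint' (mem_univ (⟨0, i⟩ : Σ n, cw.cell n)) (mem_univ ⟨0, j⟩)
    (fun h => hne (eq_of_heq (Sigma.mk.inj h).2))
  exact Set.disjoint_left.mp this ⟨0, by simp, rfl⟩ ⟨0, by simp, h.symm⟩

lemma pt_ne_seg {i : cw.cell 0} {e : cw.cell 1} {t : ℝ} (ht : t ∈ Ioo (-1 : ℝ) 1) :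
    pt cw i ≠ seg cw e t := by
  intro h
  have := cw.pairwiseDisjoint' (mem_univ (⟨0, i⟩ : Σ n, cw.cell n)) (mem_univ ⟨1, e⟩)
    (fun h => by simpa using (Sigma.mk.inj h).1)
  exact Set.disjoint_left.mp this ⟨0, by simp, rfl⟩ ⟨_, const_mem_ball ht, h.symm⟩

lemma eq_of_seg_eq_seg {e e' : cw.cell 1} {t t' : ℝ} (ht : t ∈ Ioo (-1 : ℝ) 1)
    (ht' : t' ∈ Ioo (-1 : ℝ) 1) (h : seg cw e t = seg cw e' t') : e = e' := by
  by_contra hne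
  have := cw.pairwiseDisjoint' (mem_univ (⟨1, e⟩ : Σ n, cw.cell n)) (mem_univ ⟨1, e'⟩)
    (fun h => hne (eq_of_heq (Sigma.mk.inj h).2))
  exact Set.disjoint_left.mp this ⟨_, const_mem_ball ht, rfl⟩ ⟨_, const_mem_ball ht', h.symm⟩

lemma seg_injOn (e : cw.cell 1) : InjOn (seg cw e) (Ioo (-1) 1) := by
  intro t ht t' ht' h
  refine congrFun ((cw.map 1 e).injOn ?_ ?_ h) 0
  · rw [cw.source_eq]; exact const_mem_ball ht
  · rw [cw.source_eq]; exact const_mem_ball ht'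

lemma exists_pt_eq_of_mem_sphere (e : cw.cell 1) {x : Fin 1 → ℝ}
    (hx : x ∈ sphere (0 : Fin 1 → ℝ) 1) : ∃ i, pt cw i = cw.map 1 e x := by
  obtain ⟨I, hI⟩ := cw.mapsTo' 1 e
  have := hI hx
  simp only [mem_iUnion] at this
  obtain ⟨m, hm, j, -, y, -, hy⟩ := this
  obtain rfl : m = 0 := by omega
  exact ⟨j, by rw [← hy, pt, Subsingleton.elim y 0]⟩

lemma exists_tgt (e : cw.cell 1) : ∃ i, pt cw i = seg cw e 1 :=
  exists_pt_eq_of_mem_sphere e (by simp [pi_norm_const])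

lemma exists_src (e : cw.cell 1) : ∃ i, pt cw i = seg cw e (-1) :=
  exists_pt_eq_of_mem_sphere e (by simp [pi_norm_const])

/-- The end point of an edge. -/
noncomputable def tgt (e : cw.cell 1) : cw.cell 0 := (exists_tgt e).choose

/-- The starting point of an edge. -/
noncomputable def src (e : cw.cell 1) : cw.cell 0 := (exists_src e).choose

lemma pt_tgt (e : cw.cell 1) : pt cw (tgt e) = seg cw e 1 := (exists_tgt e).choose_spec

lemma pt_src (e : cw.cell 1) : pt cw (src e) = seg cw e (-1) := (exists_src e).choose_spec

lemma eq_endpoints_or_mem_Ioo {t : ℝ} (ht : t ∈ Icc (-1 : ℝ) 1) :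
    t = -1 ∨ t = 1 ∨ t ∈ Ioo (-1 : ℝ) 1 := by
  rcases ht.1.eq_or_lt with h | h
  · exact Or.inl h.symm
  rcases ht.2.eq_or_lt with h' | h'
  · exact Or.inr (Or.inl h')
  · exact Or.inr (Or.inr ⟨h, h'⟩)

/-- The weak topology tests closedness on closed cells; 0-cells are points and impose no condition.
-/
lemma isClosed_of_seg [T2Space X] (hdim : ∀ n, 2 ≤ n → IsEmpty (cw.cell n)) {A : Set X}
    (hA : ∀ e, IsClosed (Icc (-1 : ℝ) 1 ∩ seg cw e ⁻¹' A)) : IsClosed A := by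
  refine cw.closed' A (subset_univ _) fun n j => ?_
  rcases n with _ | _ | n
  · refine (Set.Subsingleton.anti ?_ inter_subset_right).isClosed
    rintro _ ⟨x, -, rfl⟩ _ ⟨y, -, rfl⟩
    rw [Subsingleton.elim x y]
  · have : A ∩ cw.map 1 j '' closedBall 0 1 = seg cw j '' (Icc (-1 : ℝ) 1 ∩ seg cw j ⁻¹' A) := by
      ext x
      constructor
      · rintro ⟨hx, y, hy, rfl⟩
        obtain ⟨t, ht, rfl⟩ := exists_eq_const_of_mem_closedBall hy
        exact ⟨t, ⟨ht, hx⟩, rfl⟩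
      · rintro ⟨t, ⟨ht, hx⟩, rfl⟩
        exact ⟨hx, _, const_mem_closedBall ht, rfl⟩
    change IsClosed (A ∩ cw.map 1 j '' closedBall 0 1)
    rw [this]
    refine (IsCompact.image_of_continuousOn ?_
      ((continuousOn_seg cw j).mono inter_subset_left)).isClosed
    exact isCompact_Icc.of_isClosed_subset (hA j) inter_subset_left
  · exact (hdim (n + 2) (by omega)).elim j

lemma exists_pt_or_seg (hdim : ∀ n, 2 ≤ n → IsEmpty (cw.cell n)) (x : X) :
    (∃ i, x = pt cw i) ∨ ∃ e, ∃ t ∈ Ioo (-1 : ℝ) 1, x = seg cw e t := by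
  have := mem_univ x
  rw [← cw.union'] at this
  simp only [mem_iUnion] at this
  obtain ⟨n, j, y, hy, rfl⟩ := this
  rcases n with _ | _ | n
  · exact Or.inl ⟨j, by rw [pt, Subsingleton.elim y 0]⟩
  · obtain ⟨t, ht, rfl⟩ := exists_eq_const_of_mem_closedBall hy
    rcases eq_endpoints_or_mem_Ioo ht with rfl | rfl | ht
    · exact Or.inl ⟨_, (pt_src j).symm⟩
    · exact Or.inl ⟨_, (pt_tgt j).symm⟩
    · exact Or.inr ⟨j, t, ht, rfl⟩
  · exact (hdim (n + 2) (by omega)).elim j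

/-- The map to the circle which winds the edge `e` once around and is trivial elsewhere. -/
noncomputable def wind (e : cw.cell 1) (x : X) : AddCircle (1 : ℝ) :=
  open Classical in
  if h : ∃ t ∈ Ioo (-1 : ℝ) 1, x = seg cw e t then (((h.choose + 1) / 2 : ℝ) : AddCircle (1 : ℝ))
  else 0

lemma wind_eq_zero {e : cw.cell 1} {x : X} (h : ∀ t ∈ Ioo (-1 : ℝ) 1, x ≠ seg cw e t) :
    wind e x = 0 := dif_neg fun ⟨t, ht, h'⟩ => h t ht h'

lemma wind_pt (e : cw.cell 1) (i : cw.cell 0) : wind e (pt cw i) = 0 :=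
  wind_eq_zero fun _ ht => pt_ne_seg ht

lemma ne_seg_of_ne {e e' : cw.cell 1} (h : e ≠ e') {t : ℝ} (ht : t ∈ Icc (-1 : ℝ) 1) :
    ∀ t' ∈ Ioo (-1 : ℝ) 1, seg cw e t ≠ seg cw e' t' := by
  intro t' ht'
  rcases eq_endpoints_or_mem_Ioo ht with rfl | rfl | ht
  · rw [← pt_src]; exact pt_ne_seg ht'
  · rw [← pt_tgt]; exact pt_ne_seg ht'
  · exact fun h' => h (eq_of_seg_eq_seg ht ht' h')

lemma wind_seg (e : cw.cell 1) {t : ℝ} (ht : t ∈ Icc (-1 : ℝ) 1) :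
    wind e (seg cw e t) = (((t + 1) / 2 : ℝ) : AddCircle (1 : ℝ)) := by
  rcases eq_endpoints_or_mem_Ioo ht with rfl | rfl | ht
  · rw [← pt_src, wind_pt]; simp
  · rw [← pt_tgt, wind_pt]
    norm_num
    exact (AddCircle.coe_period (1 : ℝ)).symm
  · have h : ∃ t' ∈ Ioo (-1 : ℝ) 1, seg cw e t = seg cw e t' := ⟨t, ht, rfl⟩
    rw [wind, dif_pos h, ← seg_injOn e ht h.choose_spec.1 h.choose_spec.2]

lemma continuous_wind [T2Space X] (hdim : ∀ n, 2 ≤ n → IsEmpty (cw.cell n)) (e : cw.cell 1) :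
    Continuous (wind e) := by
  rw [continuous_iff_isClosed]
  intro B hB
  refine isClosed_of_seg hdim fun e' => ?_
  by_cases he : e' = e
  · subst he
    have : Icc (-1 : ℝ) 1 ∩ seg cw e' ⁻¹' (wind e' ⁻¹' B) =
        Icc (-1 : ℝ) 1 ∩ (fun t : ℝ => (((t + 1) / 2 : ℝ) : AddCircle (1 : ℝ))) ⁻¹' B := by
      ext t
      refine and_congr_right fun ht => ?_
      rw [mem_preimage, mem_preimage, wind_seg e' ht, mem_preimage]
    rw [this]
    refine isClosed_Icc.inter (hB.preimage ?_)
    exact (AddCircle.continuous_mk' (1 : ℝ)).comp (by fun_prop)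
  · have : Icc (-1 : ℝ) 1 ∩ seg cw e' ⁻¹' (wind e ⁻¹' B) =
        Icc (-1 : ℝ) 1 ∩ {_t | (0 : AddCircle (1 : ℝ)) ∈ B} := by
      ext t
      refine and_congr_right fun ht => ?_
      rw [mem_preimage, mem_preimage, wind_eq_zero (ne_seg_of_ne he ht)]
      rfl
    rw [this]
    exact isClosed_Icc.inter isClosed_const

/-- A contraction run backwards is a homotopy from a constant map to `f`. Lift it through the
covering `ℝ → ℝ/ℤ`, starting from a constant, and evaluate at time 1. -/
lemma exists_lift [ContractibleSpace X] {f : X → AddCircle (1 : ℝ)} (hf : Continuous f) :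
    ∃ h : X → ℝ, Continuous h ∧ ∀ x, ((h x : ℝ) : AddCircle (1 : ℝ)) = f x := by
  obtain ⟨x₀, ⟨H⟩⟩ := id_nullhomotopic X
  obtain ⟨y₀, hy₀⟩ := QuotientAddGroup.mk_surjective (f x₀)
  let H' : C(unitInterval × X, AddCircle (1 : ℝ)) := (⟨f, hf⟩ : C(X, _)).comp H.symm.toContinuousMap
  have cov := AddCircle.isCoveringMap_coe (1 : ℝ)
  have h0 : ∀ a, H' (0, a) = ((ContinuousMap.const X y₀ a : ℝ) : AddCircle (1 : ℝ)) := by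
    intro a
    change f (H.symm (0, a)) = _
    rw [H.symm.apply_zero]
    exact hy₀.symm
  refine ⟨fun x => cov.liftHomotopy H' (ContinuousMap.const X y₀) h0 (1, x), by fun_prop,
    fun x => ?_⟩
  have := congrFun (cov.liftHomotopy_lifts H' (ContinuousMap.const X y₀) h0) (1, x)
  refine this.trans ?_
  change f (H.symm (1, x)) = _
  rw [H.symm.apply_one]
  rfl

/-- On `S` the function takes integer values, so a non-constant one would have to skip a
half-integer. -/
lemma eq_of_isPreconnected_of_coe_eq_zero {Y : Type*} [TopologicalSpace Y] {S : Set Y}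
    (hS : IsPreconnected S) {h : Y → ℝ} (hc : ContinuousOn h S)
    (h0 : ∀ y ∈ S, ((h y : ℝ) : AddCircle (1 : ℝ)) = 0) {a b : Y} (ha : a ∈ S) (hb : b ∈ S) :
    h a = h b := by
  have hint : ∀ y ∈ S, ∃ n : ℤ, (n : ℝ) = h y := fun y hy => by
    obtain ⟨n, hn⟩ := AddCircle.coe_eq_zero_iff (1 : ℝ) |>.mp (h0 y hy)
    exact ⟨n, by simpa using hn⟩
  have key : ∀ a ∈ S, ∀ b ∈ S, ¬ h a < h b := by
    intro a ha b hb hlt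
    obtain ⟨m, hm⟩ := hint a ha
    obtain ⟨n, hn⟩ := hint b hb
    rw [← hm, ← hn, Int.cast_lt] at hlt
    have hmid : (m : ℝ) + 1 / 2 ∈ h '' S := by
      refine (hS.image h hc).Icc_subset ⟨a, ha, rfl⟩ ⟨b, hb, rfl⟩ ⟨?_, ?_⟩
      · rw [← hm]; linarith
      · rw [← hn]
        have : (m : ℝ) + 1 ≤ n := by exact_mod_cast hlt
        linarith
    obtain ⟨y, hy, hy'⟩ := hmid
    obtain ⟨k, hk⟩ := hint y hy
    rw [← hk] at hy'
    have h1 : (2 * k : ℝ) = 2 * m + 1 := by linarith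
    have h2 : 2 * k = 2 * m + 1 := by exact_mod_cast h1
    omega
  exact le_antisymm (not_lt.mp (key b hb a ha)) (not_lt.mp (key a ha b hb))

/-- The height function of an edge: a continuous function to the reals that increases by one along
the edge and is locally constant elsewhere. -/
lemma exists_height [T2Space X] [ContractibleSpace X] (hdim : ∀ n, 2 ≤ n → IsEmpty (cw.cell n))
    (e : cw.cell 1) : ∃ h : X → ℝ,
      (h (seg cw e 1) - h (seg cw e (-1)) = 1) ∧
      (∀ e' ≠ e, h (seg cw e' 1) = h (seg cw e' (-1))) ∧
      ∀ S : Set X, IsPreconnected S → (∀ t ∈ Ioo (-1 : ℝ) 1, seg cw e t ∉ S) →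
        ∀ a ∈ S, ∀ b ∈ S, h a = h b := by
  obtain ⟨h, hc, hh⟩ := exists_lift (continuous_wind hdim e)
  have hone : (1 : ℝ) ∈ Icc (-1 : ℝ) 1 := by norm_num
  have hneg : (-1 : ℝ) ∈ Icc (-1 : ℝ) 1 := by norm_num
  have hlast : ∀ S : Set X, IsPreconnected S → (∀ t ∈ Ioo (-1 : ℝ) 1, seg cw e t ∉ S) →
        ∀ a ∈ S, ∀ b ∈ S, h a = h b := by
    intro S hS hSe a ha b hb
    refine eq_of_isPreconnected_of_coe_eq_zero hS hc.continuousOn (fun y hy => ?_) ha hb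
    rw [hh]
    exact wind_eq_zero fun t ht hyt => hSe t ht (hyt ▸ hy)
  refine ⟨h, ?_, fun e' he' => ?_, hlast⟩
  · have := eq_of_isPreconnected_of_coe_eq_zero (S := Icc (-1 : ℝ) 1)
      (h := fun t => h (seg cw e t) - (t + 1) / 2) isPreconnected_Icc
      ((hc.comp_continuousOn (continuousOn_seg cw e)).sub (by fun_prop))
      (fun t ht => by rw [AddCircle.coe_sub, hh, wind_seg e ht, sub_self]) hone hneg
    norm_num at this
    linarith
  · refine hlast (seg cw e' '' Icc (-1) 1)
      (isPreconnected_Icc.image _ (continuousOn_seg cw e')) ?_ _ ⟨_, hone, rfl⟩ _ ⟨_, hneg, rfl⟩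
    rintro t ht ⟨t', ht', h'⟩
    exact ne_seg_of_ne he' ht' t ht h'

/-- The boundary of an edge. -/
noncomputable def boundary (e : cw.cell 1) : cw.cell 0 →₀ ℤ :=
  Finsupp.single (tgt e) 1 - Finsupp.single (src e) 1

/-- The vertices homologous to `v`, together with the open edges starting at them, form a clopen
set, because the two ends of an edge are homologous. -/
lemma exists_chain [T2Space X] [PreconnectedSpace X] (hdim : ∀ n, 2 ≤ n → IsEmpty (cw.cell n))
    (u v : cw.cell 0) : ∃ z : cw.cell 1 →₀ ℤ, Finsupp.linearCombination ℤ boundary z =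
      Finsupp.single u 1 - Finsupp.single v 1 := by
  let P : cw.cell 0 → Prop := fun u => ∃ z : cw.cell 1 →₀ ℤ,
    Finsupp.linearCombination ℤ boundary z = Finsupp.single u 1 - Finsupp.single v 1
  have hP : ∀ e : cw.cell 1, P (tgt e) ↔ P (src e) := by
    intro e
    constructor
    · rintro ⟨z, hz⟩
      refine ⟨z - Finsupp.single e 1, ?_⟩
      rw [map_sub, hz, Finsupp.linearCombination_single, one_smul, boundary]
      abel
    · rintro ⟨z, hz⟩
      refine ⟨z + Finsupp.single e 1, ?_⟩
      rw [map_add, hz, Finsupp.linearCombination_single, one_smul, boundary]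
      abel
  let A : Set X := {x | (∃ i, P i ∧ x = pt cw i) ∨
    ∃ e, P (src e) ∧ ∃ t ∈ Ioo (-1 : ℝ) 1, x = seg cw e t}
  have hApt : ∀ i, pt cw i ∈ A ↔ P i := by
    intro i
    constructor
    · rintro (⟨j, hj, h⟩ | ⟨e, -, t, ht, h⟩)
      · rwa [pt_injective h]
      · exact absurd h (pt_ne_seg ht)
    · exact fun h => Or.inl ⟨i, h, rfl⟩
  have hAseg : ∀ e, ∀ t ∈ Icc (-1 : ℝ) 1, (seg cw e t ∈ A ↔ P (src e)) := by
    intro e t ht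
    rcases eq_endpoints_or_mem_Ioo ht with rfl | rfl | ht
    · rw [← pt_src, hApt]
    · rw [← pt_tgt, hApt, hP]
    · constructor
      · rintro (⟨j, hj, h⟩ | ⟨e', he', t', ht', h⟩)
        · exact absurd h.symm (pt_ne_seg ht)
        · rwa [eq_of_seg_eq_seg ht ht' h]
      · exact fun h => Or.inr ⟨e, h, t, ht, rfl⟩
  have hcl : IsClosed A := isClosed_of_seg hdim fun e => by
    have : Icc (-1 : ℝ) 1 ∩ seg cw e ⁻¹' A = Icc (-1 : ℝ) 1 ∩ {_t | P (src e)} := by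
      ext t
      exact and_congr_right fun ht => hAseg e t ht
    rw [this]
    exact isClosed_Icc.inter isClosed_const
  have hop : IsClosed Aᶜ := isClosed_of_seg hdim fun e => by
    have : Icc (-1 : ℝ) 1 ∩ seg cw e ⁻¹' Aᶜ = Icc (-1 : ℝ) 1 ∩ {_t | ¬ P (src e)} := by
      ext t
      exact and_congr_right fun ht => not_congr (hAseg e t ht)
    rw [this]
    exact isClosed_Icc.inter isClosed_const
  have hclopen : IsClopen A := ⟨hcl, isClosed_compl_iff.mp hop⟩
  have huniv := hclopen.eq_univ ⟨pt cw v, (hApt v).mpr ⟨0, by simp⟩⟩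
  exact (hApt u).mp (huniv ▸ mem_univ _)

end OneDimensionalCW

/-! ### The cellular chains of a one-dimensional model as an augmentation retract. -/

namespace OneDimensionalCW

open Topology Metric Set MulAction

variable {Γ : Type u} [Group Γ] {X : Type u} [TopologicalSpace X] [MulAction Γ X]
  (C : EquivariantCWStructure Γ X)

/-- The action on vertices. -/
noncomputable local instance vertexAction : MulAction Γ (C.cw.cell 0) := C.cellAction 0

/-- The action on edges. -/
noncomputable local instance edgeAction : MulAction Γ (C.cw.cell 1) := C.cellAction 1

lemma pt_smul (g : Γ) (i : C.cw.cell 0) : pt C.cw (g • i) = g • pt C.cw i :=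
  C.map_smul 0 g i 0 (by simp)

lemma seg_smul (g : Γ) (e : C.cw.cell 1) {t : ℝ} (ht : t ∈ Icc (-1 : ℝ) 1) :
    seg C.cw (g • e) t = g • seg C.cw e t :=
  C.map_smul 1 g e _ (const_mem_closedBall ht)

lemma tgt_smul (g : Γ) (e : C.cw.cell 1) : tgt (g • e) = g • tgt e := by
  apply pt_injective
  rw [pt_tgt, pt_smul, pt_tgt, seg_smul C g e (by norm_num)]

lemma src_smul (g : Γ) (e : C.cw.cell 1) : src (g • e) = g • src e := by
  apply pt_injective
  rw [pt_src, pt_smul, pt_src, seg_smul C g e (by norm_num)]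

lemma smul_edge_eq_of_smul_seg_eq {g : Γ} {e : C.cw.cell 1} {t : ℝ} (ht : t ∈ Ioo (-1 : ℝ) 1)
    (h : g • seg C.cw e t = seg C.cw e t) : g • e = e := by
  rw [← seg_smul C g e (Ioo_subset_Icc_self ht)] at h
  exact eq_of_seg_eq_seg ht ht h

lemma boundary_smul (g : Γ) (e : C.cw.cell 1) (v : C.cw.cell 0) :
    boundary (g • e) (g • v) = boundary e v := by
  classical
  simp only [boundary, tgt_smul, src_smul, Finsupp.sub_apply, Finsupp.single_apply,
    smul_left_cancel_iff]

lemma stabilizer_edge_le_of_boundary_ne_zero {e : C.cw.cell 1} {v : C.cw.cell 0}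
    (h : boundary e v ≠ 0) : stabilizer Γ e ≤ stabilizer Γ v := by
  classical
  intro k hk
  rw [mem_stabilizer_iff] at hk ⊢
  by_cases h1 : tgt e = v
  · rw [← h1, ← tgt_smul, hk]
  by_cases h2 : src e = v
  · rw [← h2, ← src_smul, hk]
  · refine absurd ?_ h
    rw [boundary, Finsupp.sub_apply, Finsupp.single_apply, Finsupp.single_apply, if_neg h1,
      if_neg h2, sub_zero]

/-- The height of `e`, extended linearly to 0-chains, sends the boundary of `e` to 1 and all other
edge boundaries to 0, so it reads off the coefficient of `e`. This gives uniqueness of chains and,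
later, control of their supports. -/
lemma coeff_eq_of_boundary_eq {cw : CWComplex (Set.univ : Set X)} {e : cw.cell 1} {h : X → ℝ}
    (h1 : h (seg cw e 1) - h (seg cw e (-1)) = 1)
    (h2 : ∀ e' ≠ e, h (seg cw e' 1) = h (seg cw e' (-1))) {z : cw.cell 1 →₀ ℤ} {u v : cw.cell 0}
    (hz : Finsupp.linearCombination ℤ boundary z = Finsupp.single u 1 - Finsupp.single v 1) :
    (z e : ℝ) = h (pt cw u) - h (pt cw v) := by
  classical
  have hb : ∀ e', Finsupp.linearCombination ℤ (fun i => h (pt cw i)) (boundary e') =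
      if e' = e then 1 else 0 := by
    intro e'
    rw [boundary, map_sub, Finsupp.linearCombination_single, Finsupp.linearCombination_single,
      one_smul, one_smul, pt_tgt, pt_src]
    split_ifs with he
    · rw [he, h1]
    · rw [h2 e' he, sub_self]
  have := congrArg (Finsupp.linearCombination ℤ (fun i => h (pt cw i))) hz
  rw [Finsupp.apply_linearCombination, map_sub, Finsupp.linearCombination_single,
    Finsupp.linearCombination_single, one_smul, one_smul] at this
  rw [← this, Finsupp.linearCombination_apply, Finsupp.sum]
  simp only [Function.comp, hb, smul_ite, smul_zero]
  rw [Finset.sum_ite_eq']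
  split_ifs with he
  · simp
  · simp [Finsupp.notMem_support_iff.mp he]

lemma stabilizer_mem_of_isClassifying {F : SubgroupFamily Γ} (hF : F.IsClassifying X) (x : X) :
    stabilizer Γ x ∈ F.carrier := by
  by_contra h
  have := hF.empty _ h
  exact Set.notMem_empty x (this ▸ fun m => m.2)

variable [T2Space X] [ContractibleSpace X] (hdim : ∀ n, 2 ≤ n → IsEmpty (C.cw.cell n))

/-- A chain bounding the difference of two vertices. -/
noncomputable def chain (u v : C.cw.cell 0) : C.cw.cell 1 →₀ ℤ :=
  (exists_chain hdim u v).choose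

lemma boundary_chain (u v : C.cw.cell 0) :
    Finsupp.linearCombination ℤ boundary (chain C hdim u v) =
      Finsupp.single u 1 - Finsupp.single v 1 :=
  (exists_chain hdim u v).choose_spec

lemma eq_chain {z : C.cw.cell 1 →₀ ℤ} {u v : C.cw.cell 0}
    (hz : Finsupp.linearCombination ℤ boundary z = Finsupp.single u 1 - Finsupp.single v 1) :
    z = chain C hdim u v := by
  ext e
  obtain ⟨h, h1, h2, -⟩ := exists_height hdim e
  have := (coeff_eq_of_boundary_eq h1 h2 hz).trans
    (coeff_eq_of_boundary_eq h1 h2 (boundary_chain C hdim u v)).symm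
  exact_mod_cast this

lemma chain_smul (g : Γ) (u v : C.cw.cell 0) :
    chain C hdim (g • u) (g • v) = (chain C hdim u v).mapDomain (g • ·) := by
  refine (eq_chain C hdim ?_).symm
  have hb : (boundary ∘ (g • ·) : C.cw.cell 1 → _) =
      Finsupp.lmapDomain ℤ ℤ (g • · : C.cw.cell 0 → C.cw.cell 0) ∘ boundary := by
    funext e
    simp [boundary, tgt_smul, src_smul, Finsupp.mapDomain_sub]
  rw [Finsupp.linearCombination_mapDomain, hb, ← Finsupp.apply_linearCombination, boundary_chain]
  simp [Finsupp.mapDomain_sub]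

variable {F : SubgroupFamily Γ}

/-- If some element of `K` moves `e`, the connected set of `K`-fixed points misses the open edge, so
the height of `e` agrees at `u` and `v` and the coefficient vanishes. -/
lemma le_stabilizer_of_chain_ne_zero (hF : F.IsClassifying X) {K : Subgroup Γ} (hK : K ∈ F)
    {u v : C.cw.cell 0} (hu : K ≤ stabilizer Γ u) (hv : K ≤ stabilizer Γ v)
    {e : C.cw.cell 1} (he : chain C hdim u v e ≠ 0) : K ≤ stabilizer Γ e := by
  intro k hk
  by_contra hke
  refine he ?_
  obtain ⟨h, h1, h2, h3⟩ := exists_height hdim e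
  have := hF.contractible K hK
  have hpre : IsPreconnected (fixedPoints K X) := isPreconnected_iff_preconnectedSpace.mpr
    inferInstance
  have hpt : ∀ w : C.cw.cell 0, K ≤ stabilizer Γ w → pt C.cw w ∈ fixedPoints K X := by
    intro w hw m
    change (m : Γ) • pt C.cw w = _
    rw [← pt_smul, hw m.2]
  have h4 := h3 _ hpre (fun t ht hmem => hke (smul_edge_eq_of_smul_seg_eq C ht (hmem ⟨k, hk⟩)))
    _ (hpt u hu) _ (hpt v hv)
  have h5 := coeff_eq_of_boundary_eq h1 h2 (boundary_chain C hdim u v)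
  rw [h4, sub_self] at h5
  exact_mod_cast h5

/-- The cellular chain complex of a one-dimensional model for the classifying space is an
augmentation retract. -/
noncomputable def augmentationRetract (hF : F.IsClassifying X) :
    AugmentationRetract Γ F.carrier (C.cw.cell 0) (C.cw.cell 1) where
  d := chain C hdim
  r := boundary
  d_add_d u v w := by
    refine eq_chain C hdim ?_
    rw [map_add, boundary_chain, boundary_chain]
    abel
  d_smul g u v e := by
    rw [chain_smul, Finsupp.mapDomain_apply (MulAction.injective g)]
  r_smul := boundary_smul C
  d_le K hK u v e hu hv he := le_stabilizer_of_chain_ne_zero C hdim hF hK hu hv he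
  r_le e v h := stabilizer_edge_le_of_boundary_ne_zero C h
  r_sum e := by simp [boundary]
  r_d := boundary_chain C hdim
  stabilizer_mem v := by
    refine F.mem_of_le _ (stabilizer_mem_of_isClassifying hF (pt C.cw v)) _ fun k hk => ?_
    rw [mem_stabilizer_iff, ← pt_smul, hk]
  stabilizer_mem' e := by
    refine F.mem_of_le _ (stabilizer_mem_of_isClassifying hF (seg C.cw e 0)) _ fun k hk => ?_
    rw [mem_stabilizer_iff, ← seg_smul C k e (by norm_num), hk]
  exists_le K hK := by
    have := hF.contractible K hK
    obtain ⟨x, hx⟩ : Nonempty (fixedPoints K X) := inferInstance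
    rcases exists_pt_or_seg hdim x with ⟨i, rfl⟩ | ⟨e, t, ht, rfl⟩
    · refine ⟨i, fun k hk => ?_⟩
      apply pt_injective
      rw [pt_smul]
      exact hx ⟨k, hk⟩
    · refine ⟨src e, fun k hk => ?_⟩
      rw [mem_stabilizer_iff, ← src_smul, smul_edge_eq_of_smul_seg_eq C ht (hx ⟨k, hk⟩)]

end OneDimensionalCW

/-! ### From geometric dimension one to a retract, and the reduction to finite groups. -/

namespace SubgroupFamily

variable {Γ : Type u} [Group Γ] {F : SubgroupFamily Γ}

lemma nonempty_augmentationRetract_of_geometricDimension (h : F.geometricDimension = 1) :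
    ∃ (V E : Type u) (_ : MulAction Γ V) (_ : MulAction Γ E),
      Nonempty (AugmentationRetract Γ F.carrier V E) := by
  have hne : {d : WithBot ℕ∞ | ∃ (X : Type u) (_ : TopologicalSpace X) (_ : T2Space X)
    (_ : MulAction Γ X) (_ : ContinuousConstSMul Γ X) (C : EquivariantCWStructure Γ X),
    F.IsClassifying X ∧ C.dim = d}.Nonempty := by
    -- Without any model the infimum would be `⊤`; a nonempty infimum in `WithBot ℕ∞` is attained.
    by_contra hempty
    rw [geometricDimension, Set.not_nonempty_iff_eq_empty.mp hempty, sInf_empty] at h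
    exact absurd h (by decide)
  have hmem := csInf_mem hne
  obtain ⟨X, _, _, _, _, C, hC, hdim⟩ := hmem
  have hdim1 : C.dim = 1 := hdim.trans h
  have hcell : ∀ n, 2 ≤ n → IsEmpty (C.cw.cell n) := by
    intro n hn
    by_contra hne
    rw [not_isEmpty_iff] at hne
    have h1 : ((n : ℕ) : WithBot ℕ∞) ≤ C.dim :=
      le_iSup₂ (f := fun (n : ℕ) (_ : Nonempty (C.cw.cell n)) => (n : WithBot ℕ∞)) n hne
    rw [hdim1] at h1
    have h2 : n ≤ 1 := by exact_mod_cast h1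
    omega
  have hX : ContractibleSpace X := by
    have := hC.contractible ⊥ F.bot_mem
    have huniv : MulAction.fixedPoints (⊥ : Subgroup Γ) X = Set.univ := by
      ext x
      simp only [Set.mem_univ, iff_true]
      rintro ⟨m, hm⟩
      rw [Subgroup.mem_bot] at hm
      subst hm
      exact one_smul Γ x
    rw [huniv] at this
    exact (Homeomorph.Set.univ X).symm.contractibleSpace
  exact ⟨_, _, _, _, ⟨OneDimensionalCW.augmentationRetract C hcell hC⟩⟩

/-- A family which admits an augmentation retract contains all finite subgroups. -/
lemma mem_of_finite {V E : Type*} [MulAction Γ V] [MulAction Γ E]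
    (D : AugmentationRetract Γ F.carrier V E) (H : Subgroup Γ) (hH : Finite H) : H ∈ F := by
  induction hn : Nat.card H using Nat.strong_induction_on generalizing H with
  | _ n ih =>
    by_contra hHF
    have : Nontrivial H := by
      rw [Subgroup.nontrivial_iff_ne_bot]
      rintro rfl
      exact hHF F.bot_mem
    -- By induction on the order all proper subgroups of `H` lie in `F`, while `H` does not: the
    -- restricted family consists exactly of the proper subgroups.
    refine (D.restrict H).false_of_finite fun K => ?_
    constructor
    · rintro hK rfl
      refine hHF ?_
      have : (⊤ : Subgroup H).map H.subtype = H := by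
        rw [← MonoidHom.range_eq_map, Subgroup.range_subtype]
      exact this ▸ hK
    · intro hK
      have hlt : K.map H.subtype < H := lt_of_le_of_ne (Subgroup.map_subtype_le K) fun h => by
        refine hK (Subgroup.map_injective H.subtype_injective ?_)
        rw [h, ← MonoidHom.range_eq_map, Subgroup.range_subtype]
      have hfin : Finite (K.map H.subtype) := Finite.Set.subset (H : Set Γ) hlt.le
      refine ih _ ?_ _ hfin rfl
      have := Subgroup.two_mul_card_le_of_lt (G := H) (K := K) (L := ⊤) (lt_top_iff_ne_top.mpr hK)
      have hpos : 0 < Nat.card K := Nat.card_pos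
      rw [Subgroup.card_top] at this
      rw [← hn, Nat.card_congr
        (Subgroup.equivMapOfInjective K H.subtype H.subtype_injective).toEquiv.symm]
      omega

end SubgroupFamily

theorem corollary1p7 {Γ : Type u} [Group Γ] (F : SubgroupFamily Γ)
    (hF : ¬ ∀ H : Subgroup Γ, Finite H → H ∈ F) :
    (F.cohomologicalDimension = 1 ↔ F.geometricDimension = 1) ∧
      F.cohomologicalDimension ≠ 1 ∧ F.geometricDimension ≠ 1 := by
  have hcd : F.cohomologicalDimension ≠ 1 := fun h => by
    obtain ⟨V, E, _, _, ⟨D⟩⟩ :=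
      SubgroupFamily.nonempty_augmentationRetract_of_cohomologicalDimension h
    exact hF (SubgroupFamily.mem_of_finite D)
  have hgd : F.geometricDimension ≠ 1 := fun h => by
    obtain ⟨V, E, _, _, ⟨D⟩⟩ :=
      SubgroupFamily.nonempty_augmentationRetract_of_geometricDimension h
    exact hF (SubgroupFamily.mem_of_finite D)
  exact ⟨iff_of_false hcd hgd, hcd, hgd⟩
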